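/- **Definitions.** All sets lie in the Euclidean plane $\mathbb{R}^2$. For $r>0$, $\mathrm{offset}(X,r)=X\oplus D_r=\{x+v\mid x\in X,\ \|v\|\le r\}$ is the Minkowski sum of $X$ with the closed disk $D_r$ of radius $r$ around the origin. We say that the boundary $\partial X$ of a closed set $X$ *consists of* finitely many pieces (nondegenerate straight-line segments and nondegenerate circular arcs) if $\partial X$ is the union of these pieces and any two different pieces meet only in common endpoints. A *polygonal region* is a closed set whose boundary consists of finitely many line segments. A circular arc $\gamma\subseteq\partial X$ is a *dent* with respect to $X$ if no line segment connecting two distinct points of $\gamma$ is fully contained in $X$; otherwise it is a *bulge*. A closed set $X$ is an *indented* (resp. *bulged*) *region with radius $r$* if $\partial X$ consists of finitely many line segments and dents (resp. bulges), where all the arcs have radius $r$ and lie in the closure of the interior of $X$ (so that no arc is a one-dimensional part of $X$). **Theorem.** Let $P$ be an indented region with radius $r_1>0$, and let $r_2>r_1$. Then there is a polygonal region $P_L\subseteq P$ such that $$\mathrm{offset}(P,r_2)=\mathrm{offset}(P_L,r_2).$$ In particular, $\mathrm{offset}(P,r_2)$ is a bulged region with radius $r_2$. -/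

import Mathlib

open scoped Pointwise

namespace OffsetRegion

/-- The Euclidean plane. -/
abbrev Plane : Type := EuclideanSpace ℝ (Fin 2)

/-- The `r`-offset of `X`: the Minkowski sum of `X` and the closed disk of radius `r` around the
origin. -/
def offset (X : Set Plane) (r : ℝ) : Set Plane := X + Metric.closedBall (0 : Plane) r

/-- The point at angle `θ` on the circle of radius `ρ` around `c`. -/
noncomputable def circlePoint (c : Plane) (ρ θ : ℝ) : Plane :=
  c + ρ • !₂[Real.cos θ, Real.sin θ]

/-- A nondegenerate straight-line segment. -/
structure LineSegment where
  source : Plane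
  target : Plane
  source_ne_target : source ≠ target

/-- A nondegenerate circular arc, traversed counterclockwise from `startAngle` to `endAngle`.
A full circle (with one marked point) is admitted. -/
structure CircularArc where
  center : Plane
  radius : ℝ
  startAngle : ℝ
  endAngle : ℝ
  radius_pos : 0 < radius
  start_lt_end : startAngle < endAngle
  end_le : endAngle ≤ startAngle + 2 * Real.pi

/-- The set of points of a (closed) circular arc. -/
def CircularArc.carrier (γ : CircularArc) : Set Plane :=
  circlePoint γ.center γ.radius '' Set.Icc γ.startAngle γ.endAngle

/-- A piece of boundary: a straight-line segment or a circular arc. -/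
inductive Piece where
  | seg (s : LineSegment)
  | arc (γ : CircularArc)

namespace Piece

/-- The set of points of a piece (with its endpoints). -/
def carrier : Piece → Set Plane
  | seg s => segment ℝ s.source s.target
  | arc γ => γ.carrier

/-- The endpoints of a piece. -/
def endpoints : Piece → Set Plane
  | seg s => {s.source, s.target}
  | arc γ => {circlePoint γ.center γ.radius γ.startAngle,
      circlePoint γ.center γ.radius γ.endAngle}

end Piece

/-- `X` is a closed set whose boundary consists of the finitely many pieces in `F`, interlinked
at the vertices: two different pieces meet only in common endpoints. -/
structure BoundaryConsistsOf (X : Set Plane) (F : Set Piece) : Prop where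
  isClosed : IsClosed X
  finite : F.Finite
  frontier_eq : frontier X = ⋃ p ∈ F, p.carrier
  linked : ∀ p ∈ F, ∀ q ∈ F, p ≠ q → p.carrier ∩ q.carrier ⊆ p.endpoints ∩ q.endpoints

/-- A polygonal region: the boundary consists of finitely many line segments. -/
def IsPolygonalRegion (X : Set Plane) : Prop :=
  ∃ F : Set Piece, BoundaryConsistsOf X F ∧ ∀ p ∈ F, ∃ s, p = Piece.seg s

/-- An arc `γ` on the boundary of `X` is a dent if no segment that connects two distinct points of
`γ` is fully contained in `X`. -/
def IsDent (X : Set Plane) (γ : CircularArc) : Prop :=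
  ∀ x ∈ γ.carrier, ∀ y ∈ γ.carrier, x ≠ y → ¬ segment ℝ x y ⊆ X

/-- An arc on the boundary of `X` is a bulge if it is not a dent. -/
def IsBulge (X : Set Plane) (γ : CircularArc) : Prop := ¬ IsDent X γ

/-- An indented region with radius `r`: the boundary consists of finitely many segments and dents
of radius `r`. The condition on `closure (interior X)` says that the arcs bound a two-dimensional
part of `X`; a curve that is itself a one-dimensional part of `X` is not a dent of a region. -/
def IsIndentedRegion (X : Set Plane) (r : ℝ) : Prop :=
  ∃ F : Set Piece, BoundaryConsistsOf X F ∧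
    ∀ γ, Piece.arc γ ∈ F → γ.radius = r ∧ IsDent X γ ∧ γ.carrier ⊆ closure (interior X)

/-- A bulged region with radius `r`: the boundary consists of finitely many segments and bulges
of radius `r`, and these arcs bound a two-dimensional part of `X`. -/
def IsBulgedRegion (X : Set Plane) (r : ℝ) : Prop :=
  ∃ F : Set Piece, BoundaryConsistsOf X F ∧
    ∀ γ, Piece.arc γ ∈ F → γ.radius = r ∧ IsBulge X γ ∧ γ.carrier ⊆ closure (interior X)

end OffsetRegion

/-! Let `z` lie in the offset and let `q` be its nearest point in `P`. If `q` is an inner point of a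
dent, then `z` lies on the ray from the center of the dent through `q`. Just outside the circle, `P`
is solid near `q`: otherwise it would be solid on the inside and contain a short chord of the dent.
So `z` cannot lie beyond the circle, and its distance from `q` is at most `r₁`
(`dist_le_radius_of_nearest`). Hence a nearest point at distance more than `r₁` lies on a boundary
segment or is an endpoint of a piece.

A subset of `P` that contains these segments and endpoints and is `(r₂ - r₁)`-dense in `P` therefore
has the same offset (`offset_eq_of_dense`). Such a set arises by removing small open squares that
cover the dents, taking the closure of the interior, and adding finitely many segments of `P`. An
endpoint of a dent must not become an isolated point, so it needs a nondegenerate segment in `P`. If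
no boundary segment contains it, a tangent segment works: other circles of the same radius through
the endpoint do not enter the sliver between circle and tangent (`eventually_dist_ne`,
`exists_tangent_segment_subset`).

For the offset itself, frontier points have distance exactly `r₂ > r₁` from `P`, so they lie on
parallels of boundary segments or on circles of radius `r₂` around endpoints. These circles bound
disks contained in the offset, so their arcs are bulges.

Both parts need a decomposition of a frontier into finitely many linked pieces
(`exists_boundaryConsistsOf_isSegOrArc`). Away from finitely many vertices, the frontier lies
locally on one line or circle. At a limit of interior points, one side of this curve is inside the
set and the other outside, so the frontier fills the curve locally. Between consecutive vertices it
is then everything or nothing. -/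

namespace OffsetRegion

open Metric Set Filter Topology

/-! ### Connected sets that avoid a frontier -/

section Topological

variable {E : Type*} [TopologicalSpace E]

/-- Interior and exterior are disjoint open sets that cover the complement of the frontier. -/
theorem subset_interior_or_subset_compl {S X : Set E} (hS : IsPreconnected S)
    (h : Disjoint S (frontier X)) : S ⊆ interior X ∨ S ⊆ (closure X)ᶜ := by
  refine hS.subset_or_subset isOpen_interior isClosed_closure.isOpen_compl ?_ ?_
  · exact disjoint_compl_right.mono_left (interior_subset.trans subset_closure)
  · intro x hx
    by_contra hc
    simp only [mem_union, mem_compl_iff, not_or, not_not] at hc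
    exact disjoint_left.1 h hx ⟨hc.2, hc.1⟩

end Topological

/-! ### Lines and circles separate the plane locally -/

/-- A continuous function whose zero set locally separates space into two connected sides. -/
structure LocallySeparates (f : Plane → ℝ) : Prop where
  continuous : Continuous f
  pos_side : ∀ p, f p = 0 → ∀ ε > 0, ∃ δ > 0, ∃ S, IsPreconnected S ∧
    S ⊆ ball p ε ∩ {x | 0 < f x} ∧ ball p δ ∩ {x | 0 < f x} ⊆ S
  neg_side : ∀ p, f p = 0 → ∀ ε > 0, ∃ δ > 0, ∃ S, IsPreconnected S ∧
    S ⊆ ball p ε ∩ {x | f x < 0} ∧ ball p δ ∩ {x | f x < 0} ⊆ S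
  mem_closure_pos : ∀ p, f p = 0 → p ∈ closure {x | 0 < f x}
  mem_closure_neg : ∀ p, f p = 0 → p ∈ closure {x | f x < 0}

theorem locallySeparates_inner (n : Plane) (hn : n ≠ 0) (d : ℝ) :
    LocallySeparates fun x => inner ℝ n x - d := by
  have hnn : 0 < inner ℝ n n := by rw [real_inner_self_eq_norm_sq]; positivity
  have hlin : IsLinearMap ℝ fun x : Plane => inner ℝ n x :=
    (innerSL ℝ n).toLinearMap.isLinear
  have key : ∀ p : Plane, ∀ s : Set ℝ, (0 : ℝ) ∈ closure s →
      p ∈ closure ((fun x : Plane => inner ℝ n x - d) ⁻¹'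
        ((fun t => (inner ℝ n p - d) + t * inner ℝ n n) '' s)) := by
    intro p s hs
    have hc : Continuous fun t : ℝ => p + t • n := by fun_prop
    have := mem_closure_image (s := s) hc.continuousAt hs
    simp only [zero_smul, add_zero] at this
    refine closure_mono ?_ this
    rintro _ ⟨t, ht, rfl⟩
    refine ⟨t, ht, ?_⟩
    simp only [inner_add_right, inner_smul_right]
    ring
  refine ⟨by fun_prop, ?_, ?_, ?_, ?_⟩
  · intro p _ ε hε
    refine ⟨ε, hε, _, ((convex_ball p ε).inter (convex_halfSpace_gt hlin d)).isPreconnected, ?_, ?_⟩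
    · rintro x ⟨h1, h2⟩; exact ⟨h1, by simpa using h2⟩
    · rintro x ⟨h1, h2⟩; exact ⟨h1, by simpa using h2⟩
  · intro p _ ε hε
    refine ⟨ε, hε, _, ((convex_ball p ε).inter (convex_halfSpace_lt hlin d)).isPreconnected, ?_, ?_⟩
    · rintro x ⟨h1, h2⟩; exact ⟨h1, by simpa using h2⟩
    · rintro x ⟨h1, h2⟩; exact ⟨h1, by simpa using h2⟩
  · intro p hp
    refine closure_mono ?_ (key p (Ioi 0) (by simp))
    rintro x ⟨t, ht, h⟩
    simp only [hp, mem_Ioi, zero_add] at ht h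
    exact lt_of_lt_of_eq (by positivity) h
  · intro p hp
    refine closure_mono ?_ (key p (Iio 0) (by simp))
    rintro x ⟨t, ht, h⟩
    simp only [hp, mem_Iio, zero_add] at ht h
    exact lt_of_eq_of_lt h.symm (mul_neg_of_neg_of_pos ht hnn)

/-- The point of the ray from `c` through `q.1` at distance `q.2` from `c`. -/
noncomputable def radial (c : Plane) (q : Plane × ℝ) : Plane :=
  c + (q.2 / ‖q.1 - c‖) • (q.1 - c)

theorem dist_radial {c : Plane} {q : Plane × ℝ} (h : q.1 ≠ c) (h2 : 0 ≤ q.2) :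
    dist (radial c q) c = q.2 := by
  have : ‖q.1 - c‖ ≠ 0 := by simpa [sub_eq_zero] using h
  simp only [radial, dist_eq_norm, add_sub_cancel_left, norm_smul, Real.norm_eq_abs, abs_div,
    abs_norm, abs_of_nonneg h2]
  field_simp

theorem radial_self {c x : Plane} : radial c (x, dist x c) = x := by
  by_cases h : x = c
  · simp [radial, h]
  · have : ‖x - c‖ ≠ 0 := by simpa [sub_eq_zero] using h
    simp [radial, dist_eq_norm, this]

/-- In polar coordinates around `c` the set is a product of convex sets. The map `radial` is
continuous on it because the ball is small enough to miss `c`. -/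
theorem exists_preconnected_radial {c p : Plane} {r : ℝ} (hr : 0 < r) (hp : dist p c = r)
    {I : Set ℝ} (hI : Convex ℝ I) {ε : ℝ} (hε : 0 < ε) :
    ∃ δ > 0, ∃ S, IsPreconnected S ∧ S ⊆ ball p ε ∩ {x | dist x c ∈ I} ∧
      ball p δ ∩ {x | dist x c ∈ I} ⊆ S := by
  have hpc : p ≠ c := by rintro rfl; simp at hp; exact hr.ne hp
  have hcont : ∀ q : Plane × ℝ, q.1 ≠ c → ContinuousAt (radial c) q := by
    intro q hq
    have : ‖q.1 - c‖ ≠ 0 := by simpa [sub_eq_zero] using hq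
    unfold radial
    fun_prop (disch := assumption)
  have h0 : radial c (p, r) = p := by rw [← hp]; exact radial_self
  have h1 : radial c ⁻¹' ball p ε ∈ 𝓝 (p, r) :=
    (hcont (p, r) hpc).preimage_mem_nhds (by rw [h0]; exact ball_mem_nhds p hε)
  obtain ⟨η, hη, hηs⟩ := Metric.mem_nhds_iff.1 h1
  obtain ⟨η, hη, hη2, hηs⟩ : ∃ η > 0, η ≤ r ∧ ball (p, r) η ⊆ radial c ⁻¹' ball p ε :=
    ⟨min η r, by positivity, min_le_right _ _, (ball_subset_ball (min_le_left _ _)).trans hηs⟩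
  have hne : ∀ x ∈ ball p η, x ≠ c := by
    rintro x hx rfl
    rw [mem_ball, dist_comm, hp] at hx
    linarith
  refine ⟨η, hη, radial c '' (ball p η ×ˢ (ball r η ∩ I)), ?_, ?_, ?_⟩
  · refine (((convex_ball p η).prod ((convex_ball r η).inter hI)).isPreconnected).image _ ?_
    intro q hq
    exact (hcont q (hne _ hq.1)).continuousWithinAt
  · rintro _ ⟨q, ⟨hq1, hq2, hq3⟩, rfl⟩
    refine ⟨hηs (by rw [← ball_prod_same]; exact ⟨hq1, hq2⟩), ?_⟩
    have : 0 ≤ q.2 := by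
      rw [Real.ball_eq_Ioo] at hq2; linarith [hq2.1]
    simpa [dist_radial (hne _ hq1) this] using hq3
  · rintro x ⟨hx1, hx2⟩
    refine ⟨(x, dist x c), ⟨hx1, ?_, hx2⟩, radial_self⟩
    rw [mem_ball, ← hp, Real.dist_eq]
    exact (abs_dist_sub_le _ _ _).trans_lt hx1

theorem locallySeparates_dist (c : Plane) {r : ℝ} (hr : 0 < r) :
    LocallySeparates fun x => dist x c - r := by
  have key : ∀ p, dist p c = r → ∀ s : Set ℝ, r ∈ closure (s ∩ Ici 0) →
      p ∈ closure {x | dist x c ∈ s} := by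
    intro p hp s hs
    have hpc : p ≠ c := by rintro rfl; simp at hp; exact hr.ne hp
    have hc : Continuous fun t : ℝ => radial c (p, t) := by
      simp only [radial, div_eq_mul_inv]; fun_prop
    have := mem_closure_image hc.continuousAt hs
    rw [← hp, radial_self] at this
    refine closure_mono ?_ this
    rintro _ ⟨t, ⟨ht, ht0⟩, rfl⟩
    simpa [dist_radial (q := (p, t)) hpc ht0] using ht
  refine ⟨by fun_prop, ?_, ?_, ?_, ?_⟩
  · intro p hp ε hε
    simpa only [mem_Ioi, sub_pos] using
      exists_preconnected_radial hr (sub_eq_zero.1 hp) (convex_Ioi r) hε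
  · intro p hp ε hε
    simpa only [mem_Iio, sub_neg] using
      exists_preconnected_radial hr (sub_eq_zero.1 hp) (convex_Iio r) hε
  · intro p hp
    simpa only [mem_Ioi, sub_pos] using key p (sub_eq_zero.1 hp) (Ioi r) (by
      have : Ioi r ∩ Ici 0 = Ioi r := inter_eq_left.2 fun x hx => (hr.trans hx).le
      rw [this]; simp)
  · intro p hp
    simpa only [mem_Iio, sub_neg] using key p (sub_eq_zero.1 hp) (Iio r) (by
      rw [inter_comm, Ici_inter_Iio, closure_Ico hr.ne]; exact ⟨hr.le, le_rfl⟩)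

/-- If near `p` the frontier of `X` lies on the zero set of `f`, and `p` is a limit of interior
points, then near `p` the whole zero set is in the frontier. -/
theorem LocallySeparates.eventually_mem_frontier {f : Plane → ℝ} (hf : LocallySeparates f)
    {X : Set Plane} (hX : IsClosed X) {p : Plane} (hp : f p = 0) (hpX : p ∈ frontier X)
    (hpi : p ∈ closure (interior X)) (hloc : ∀ᶠ y in 𝓝 p, y ∈ frontier X → f y = 0) :
    ∀ᶠ y in 𝓝[{y | f y = 0}] p, y ∈ frontier X := by
  obtain ⟨ε, hε, hεX⟩ := Metric.mem_nhds_iff.1 hloc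
  obtain ⟨δ₁, hδ₁, S, hS, hSε, hSδ⟩ := hf.pos_side p hp ε hε
  obtain ⟨δ₂, hδ₂, T, hT, hTε, hTδ⟩ := hf.neg_side p hp ε hε
  obtain ⟨δ, hδ, h1, h2⟩ : ∃ δ > 0, δ ≤ δ₁ ∧ δ ≤ δ₂ :=
    ⟨min δ₁ δ₂, by positivity, min_le_left _ _, min_le_right _ _⟩
  have hSδ' := (inter_subset_inter_left _ (ball_subset_ball h1)).trans hSδ
  have hTδ' := (inter_subset_inter_left _ (ball_subset_ball h2)).trans hTδ
  have hSd := subset_interior_or_subset_compl (X := X) hS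
    (disjoint_left.2 fun x hx hx2 => ((hSε hx).2.ne' (hεX (hSε hx).1 hx2)))
  have hTd := subset_interior_or_subset_compl (X := X) hT
    (disjoint_left.2 fun x hx hx2 => ((hTε hx).2.ne (hεX (hTε hx).1 hx2)))
  have hclS : ∀ y ∈ ball p δ, f y = 0 → y ∈ closure S := fun y hy hfy =>
    closure_mono hSδ' (isOpen_ball.inter_closure ⟨hy, hf.mem_closure_pos y hfy⟩)
  have hclT : ∀ y ∈ ball p δ, f y = 0 → y ∈ closure T := fun y hy hfy =>
    closure_mono hTδ' (isOpen_ball.inter_closure ⟨hy, hf.mem_closure_neg y hfy⟩)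
  -- Points of the zero set are limits of `S`, so an open set accumulating at `p` meets one of the
  -- sides. Applied to the interior and to the complement of `X`, this puts one side inside and the
  -- other outside.
  have meets : ∀ U : Set Plane, IsOpen U → p ∈ closure U → (U ∩ S).Nonempty ∨ (U ∩ T).Nonempty := by
    intro U hU hpU
    obtain ⟨y, hy, hyU⟩ := mem_closure_iff_nhds.1 hpU _ (ball_mem_nhds p hδ)
    rcases lt_trichotomy (f y) 0 with h | h | h
    · exact Or.inr ⟨y, hyU, hTδ' ⟨hy, h⟩⟩
    · exact Or.inl (mem_closure_iff.1 (hclS y hy h) U hU hyU)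
    · exact Or.inl ⟨y, hyU, hSδ' ⟨hy, h⟩⟩
  have hcl : p ∈ closure Xᶜ := by rw [closure_compl]; exact hpX.2
  have disj : ∀ U : Set Plane, U.Nonempty → U ⊆ interior X → U ⊆ (closure X)ᶜ → False :=
    fun U ⟨y, hy⟩ h h' => h' hy (subset_closure (interior_subset (h hy)))
  have conclude : ∀ A B : Set Plane, A ⊆ interior X → B ⊆ (closure X)ᶜ →
      closure A ∩ closure B ⊆ frontier X := by
    rintro A B hA hB y ⟨hyA, hyB⟩
    refine ⟨closure_mono (hA.trans interior_subset) hyA, ?_⟩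
    have := closure_mono (hB.trans (compl_subset_compl.2 subset_closure)) hyB
    rwa [closure_compl] at this
  have main : closure S ∩ closure T ⊆ frontier X := by
    have h1 : S ⊆ interior X ∨ T ⊆ interior X := by
      refine (meets _ isOpen_interior hpi).imp ?_ ?_ <;> rintro ⟨y, hy, hy'⟩
      · exact hSd.resolve_right fun h => h hy' (subset_closure (interior_subset hy))
      · exact hTd.resolve_right fun h => h hy' (subset_closure (interior_subset hy))
    have h2 : S ⊆ (closure X)ᶜ ∨ T ⊆ (closure X)ᶜ := by
      refine (meets _ hX.isOpen_compl hcl).imp ?_ ?_ <;> rintro ⟨y, hy, hy'⟩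
      · exact hSd.resolve_left fun h => hy (interior_subset (h hy'))
      · exact hTd.resolve_left fun h => hy (interior_subset (h hy'))
    have hSn : S.Nonempty := closure_nonempty_iff.1 ⟨p, hclS p (mem_ball_self hδ) hp⟩
    have hTn : T.Nonempty := closure_nonempty_iff.1 ⟨p, hclT p (mem_ball_self hδ) hp⟩
    rcases h1 with h1 | h1 <;> rcases h2 with h2 | h2
    · exact (disj S hSn h1 h2).elim
    · exact conclude S T h1 h2
    · rw [inter_comm]; exact conclude T S h1 h2
    · exact (disj T hTn h1 h2).elim
  filter_upwards [self_mem_nhdsWithin, mem_nhdsWithin_of_mem_nhds (ball_mem_nhds p hδ)] with y h1 h2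
  exact main ⟨hclS y h2 h1, hclT y h2 h1⟩

/-! ### Isolated points of a frontier -/

/-- The punctured plane is connected, and `univBall` carries it onto the punctured ball. -/
theorem isPreconnected_ball_diff_center (v : Plane) {ε : ℝ} (hε : 0 < ε) :
    IsPreconnected (ball v ε \ {v}) := by
  have h := (isConnected_compl_singleton_of_one_lt_rank (E := Plane)
    (by simp [rank_eq_card_basis (EuclideanSpace.basisFun (Fin 2) ℝ).toBasis]) 0).isPreconnected
  have hc := OpenPartialHomeomorph.continuous_univBall v ε
  have hinj := (OpenPartialHomeomorph.univBall v ε).injOn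
  have him := (OpenPartialHomeomorph.univBall v ε).image_source_eq_target
  rw [OpenPartialHomeomorph.univBall_source] at hinj him
  rw [OpenPartialHomeomorph.univBall_target _ hε] at him
  have himg : OpenPartialHomeomorph.univBall v ε '' {0}ᶜ = ball v ε \ {v} := by
    rw [compl_eq_univ_sdiff, hinj.image_sdiff_subset (by simp), him]
    simp
  rw [← himg]
  exact h.image _ hc.continuousOn

/-- The frontier of `X` has no isolated point, if every point of `X` is a limit of other points
of `X`. -/
theorem mem_closure_frontier_diff {X : Set Plane} (hX : IsClosed X) {v : Plane}
    (hv : v ∈ frontier X) (hacc : v ∈ closure (X \ {v})) : v ∈ closure (frontier X \ {v}) := by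
  by_contra hcon
  obtain ⟨ε, hε, h⟩ := Metric.mem_nhds_iff.1 (isClosed_closure.isOpen_compl.mem_nhds hcon)
  have hd : Disjoint (ball v ε \ {v}) (frontier X) := disjoint_left.2 fun x hx hx' =>
    h hx.1 (subset_closure ⟨hx', hx.2⟩)
  rcases subset_interior_or_subset_compl (isPreconnected_ball_diff_center v hε) hd with hi | hi
  · refine hv.2 (mem_interior.2 ⟨ball v ε, fun x hx => ?_, isOpen_ball, mem_ball_self hε⟩)
    by_cases hxv : x = v
    · rw [hxv, ← hX.closure_eq]; exact hv.1
    · exact interior_subset (hi ⟨hx, hxv⟩)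
  · obtain ⟨y, hy, hyX⟩ := mem_closure_iff_nhds.1 hacc _ (ball_mem_nhds v hε)
    exact hi ⟨hy, hyX.2⟩ (subset_closure hyX.1)

/-! ### Cutting curves at finitely many vertices -/

/-- `γ` parametrizes a curve that is injective on `[a, b]` up to a possible closing at the ends
and whose subarcs are the carriers of pieces with the property `good`. -/
structure IsCurve (good : Piece → Prop) (k : Set Plane) (γ : ℝ → Plane) (a b : ℝ) : Prop where
  lt : a < b
  continuous : Continuous γ
  mem : ∀ t, γ t ∈ k
  inj : ∀ s ∈ Ioo a b, ∀ t ∈ Ioo a b, γ s = γ t → s = t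
  sub : ∀ s t, a ≤ s → s < t → t ≤ b → ∃ p : Piece, good p ∧ p.carrier = γ '' Icc s t ∧
    p.endpoints = {γ s, γ t}

/-- `(s, t)` is a maximal interval in `[a, b]` on which the curve avoids `V`. -/
structure IsCell (γ : ℝ → Plane) (a b : ℝ) (V : Set Plane) (s t : ℝ) : Prop where
  le_left : a ≤ s
  lt : s < t
  le_right : t ≤ b
  left_mem : γ s ∈ V
  right_mem : γ t ∈ V
  notMem : ∀ u ∈ Ioo s t, γ u ∉ V

section Cells

variable {good : Piece → Prop} {k : Set Plane} {γ : ℝ → Plane} {a b : ℝ} {V : Set Plane}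

theorem IsCurve.finite_preimage (h : IsCurve good k γ a b) (hV : V.Finite) :
    (Icc a b ∩ γ ⁻¹' V).Finite := by
  have h1 : (Ioo a b ∩ γ ⁻¹' V).Finite :=
    Set.Finite.of_finite_image (f := γ) (hV.subset (by rintro _ ⟨t, ht, rfl⟩; exact ht.2))
      fun s hs t ht hst => h.inj s hs.1 t ht.1 hst
  refine (h1.union (toFinite {a, b})).subset ?_
  rintro t ⟨⟨h1, h2⟩, h3⟩
  rcases h1.eq_or_lt with rfl | h1
  · simp
  rcases h2.eq_or_lt with rfl | h2
  · simp
  exact Or.inl ⟨⟨h1, h2⟩, h3⟩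

theorem IsCurve.finite_cells (h : IsCurve good k γ a b) (hV : V.Finite) :
    {q : ℝ × ℝ | IsCell γ a b V q.1 q.2}.Finite := by
  refine ((h.finite_preimage hV).prod (h.finite_preimage hV)).subset ?_
  rintro ⟨s, t⟩ hst
  exact ⟨⟨⟨hst.le_left, hst.lt.le.trans hst.le_right⟩, hst.left_mem⟩,
    ⟨⟨hst.le_left.trans hst.lt.le, hst.le_right⟩, hst.right_mem⟩⟩

/-- Only finitely many parameters are mapped into `V`, so there is a last one before `u` and a first
one after it. -/
theorem IsCurve.exists_cell (h : IsCurve good k γ a b) (hV : V.Finite) (ha : γ a ∈ V)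
    (hb : γ b ∈ V) {u : ℝ} (hu : u ∈ Icc a b) (huV : γ u ∉ V) :
    ∃ s t, IsCell γ a b V s t ∧ u ∈ Ioo s t := by
  have hfin := h.finite_preimage hV
  obtain ⟨s, ⟨⟨hs1, hs2⟩, hsu⟩, hs⟩ := Set.exists_max_image ((Icc a b ∩ γ ⁻¹' V) ∩ Iic u) id
    (hfin.inter_of_left _) ⟨a, ⟨⟨le_rfl, h.lt.le⟩, ha⟩, hu.1⟩
  obtain ⟨t, ⟨⟨ht1, ht2⟩, htu⟩, ht⟩ := Set.exists_min_image ((Icc a b ∩ γ ⁻¹' V) ∩ Ici u) id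
    (hfin.inter_of_left _) ⟨b, ⟨⟨h.lt.le, le_rfl⟩, hb⟩, hu.2⟩
  have hsu : s < u := lt_of_le_of_ne hsu (by rintro rfl; exact huV hs2)
  have htu : u < t := lt_of_le_of_ne htu (by rintro rfl; exact huV ht2)
  refine ⟨s, t, ⟨hs1.1, hsu.trans htu, ht1.2, hs2, ht2, fun w hw hwV => ?_⟩, hsu, htu⟩
  have hwab : w ∈ Icc a b := ⟨hs1.1.trans hw.1.le, hw.2.le.trans ht1.2⟩
  rcases le_total w u with hwu | hwu
  · exact (hs w ⟨⟨hwab, hwV⟩, hwu⟩).not_gt hw.1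
  · exact (ht w ⟨⟨hwab, hwV⟩, hwu⟩).not_gt hw.2

theorem IsCell.eq_or_eq {s t u : ℝ} (h : IsCell γ a b V s t) (hu : u ∈ Icc s t) (huV : γ u ∈ V) :
    u = s ∨ u = t := by
  by_contra! hc
  exact h.notMem u ⟨lt_of_le_of_ne hu.1 hc.1.symm, lt_of_le_of_ne hu.2 hc.2⟩ huV

theorem IsCell.mem_Ioo {s t u : ℝ} (h : IsCell γ a b V s t) (hu : u ∈ Icc s t) (huV : γ u ∉ V) :
    u ∈ Ioo s t := by
  refine ⟨lt_of_le_of_ne hu.1 ?_, lt_of_le_of_ne hu.2 ?_⟩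
  · rintro rfl; exact huV h.left_mem
  · rintro rfl; exact huV h.right_mem

theorem IsCell.unique {s t s' t' u : ℝ} (h : IsCell γ a b V s t) (h' : IsCell γ a b V s' t')
    (hu : u ∈ Ioo s t) (hu' : u ∈ Ioo s' t') : s = s' ∧ t = t' := by
  have aux : ∀ {s t s' t' : ℝ}, IsCell γ a b V s t → IsCell γ a b V s' t' → u ∈ Ioo s t →
      u ∈ Ioo s' t' → s ≤ s' ∧ t' ≤ t := by
    intro s t s' t' h h' hu hu'
    refine ⟨?_, ?_⟩ <;> by_contra! hc
    · exact h'.notMem s ⟨hc, hu.1.trans hu'.2⟩ h.left_mem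
    · exact h'.notMem t ⟨hu'.1.trans hu.2, hc⟩ h.right_mem
  have h1 := aux h h' hu hu'
  have h2 := aux h' h hu' hu
  exact ⟨le_antisymm h1.1 h2.1, le_antisymm h2.2 h1.2⟩

end Cells

/-- If the frontier of a closed set `X` lies on finitely many curves with finite pairwise
intersections, is relatively open in the curves outside a finite set, and has no isolated points,
then it consists of finitely many pieces of these curves. -/
theorem exists_boundaryConsistsOf {good : Piece → Prop} {X : Set Plane} (hX : IsClosed X)
    {G : Set (Set Plane)} (hG : G.Finite)
    (hcurve : ∀ k ∈ G, ∃ γ a b, IsCurve good k γ a b ∧ k ∩ frontier X ⊆ γ '' Icc a b)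
    (hpair : ∀ k ∈ G, ∀ l ∈ G, k ≠ l → (k ∩ l).Finite)
    (hfr : frontier X ⊆ ⋃₀ G) {V₀ : Set Plane} (hV₀ : V₀.Finite)
    (hopen : ∀ k ∈ G, ∀ p ∈ k, p ∈ frontier X → p ∉ V₀ → (∀ l ∈ G, l ≠ k → p ∉ l) →
      ∀ᶠ y in 𝓝[k] p, y ∈ frontier X)
    (hacc : ∀ v ∈ frontier X, v ∈ closure (frontier X \ {v})) :
    ∃ F : Set Piece, BoundaryConsistsOf X F ∧ ∀ p ∈ F, good p := by
  classical
  choose! γ a b hγ hcov using hcurve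
  -- The vertices: exceptional points, common points of different curves, and the ends of the
  -- parametrized curves.
  obtain ⟨V, hVfin, hV₀V, hVpair, hVa, hVb⟩ : ∃ V : Set Plane, V.Finite ∧ V₀ ⊆ V ∧
      (∀ k ∈ G, ∀ l ∈ G, k ≠ l → k ∩ l ⊆ V) ∧ (∀ k ∈ G, γ k (a k) ∈ V) ∧
      (∀ k ∈ G, γ k (b k) ∈ V) := by
    refine ⟨V₀ ∪ (⋃ k ∈ G, ⋃ l ∈ G, if k = l then ∅ else k ∩ l) ∪ (⋃ k ∈ G, {γ k (a k), γ k (b k)}),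
      ((hV₀.union (hG.biUnion fun k hk => hG.biUnion fun l hl => ?_)).union
        (hG.biUnion fun k _ => toFinite _)), ?_, ?_, ?_, ?_⟩
    · split_ifs with h
      · exact finite_empty
      · exact hpair k hk l hl h
    · exact subset_union_left.trans subset_union_left
    · intro k hk l hl hkl x hx
      refine Or.inl (Or.inr ?_)
      simp only [mem_iUnion]
      exact ⟨k, hk, l, hl, by rwa [if_neg hkl]⟩
    · intro k hk
      exact Or.inr (mem_biUnion hk (by simp))
    · intro k hk
      exact Or.inr (mem_biUnion hk (by simp))
  -- Inside a cell, the parameters of frontier points form a relatively open and closed set, so a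
  -- single frontier point puts the whole cell into the frontier.
  have hcell : ∀ k ∈ G, ∀ s t, IsCell (γ k) (a k) (b k) V s t → ∀ u ∈ Ioo s t,
      γ k u ∈ frontier X → γ k '' Icc s t ⊆ frontier X := by
    intro k hk s t hst u hu huX
    have hopen' : ∀ w ∈ Ioo s t, γ k w ∈ frontier X → ∀ᶠ z in 𝓝 w, γ k z ∈ frontier X := by
      intro w hw hwX
      have hwV := hst.notMem w hw
      have := hopen k hk (γ k w) ((hγ k hk).mem w) hwX (fun h => hwV (hV₀V h))
        fun l hl hlk hwl => hwV (hVpair l hl k hk hlk ⟨hwl, (hγ k hk).mem w⟩)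
      exact (tendsto_nhdsWithin_iff.2 ⟨(hγ k hk).continuous.tendsto w,
        Eventually.of_forall (hγ k hk).mem⟩).eventually this
    have hcl : IsClosed (γ k ⁻¹' frontier X) := isClosed_frontier.preimage (hγ k hk).continuous
    have h1 : Ioo s t ⊆ interior (γ k ⁻¹' frontier X) := by
      refine isPreconnected_Ioo.subset_of_closure_inter_subset isOpen_interior
        ⟨u, hu, mem_interior_iff_mem_nhds.2 (hopen' u hu huX)⟩ ?_
      rintro w ⟨hw, hw'⟩
      exact mem_interior_iff_mem_nhds.2 (hopen' w hw' (closure_minimal interior_subset hcl hw))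
    rw [image_subset_iff, ← closure_Ioo hst.lt.ne]
    exact closure_minimal (h1.trans interior_subset) hcl
  have hpiece : ∀ q : Set Plane × ℝ × ℝ, ∃ p : Piece, q.1 ∈ G →
      IsCell (γ q.1) (a q.1) (b q.1) V q.2.1 q.2.2 →
      good p ∧ p.carrier = γ q.1 '' Icc q.2.1 q.2.2 ∧
        p.endpoints = {γ q.1 q.2.1, γ q.1 q.2.2} := by
    intro q
    by_cases h : q.1 ∈ G ∧ IsCell (γ q.1) (a q.1) (b q.1) V q.2.1 q.2.2
    · obtain ⟨p, hp⟩ := (hγ q.1 h.1).sub q.2.1 q.2.2 h.2.le_left h.2.lt h.2.le_right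
      exact ⟨p, fun _ _ => hp⟩
    -- An arbitrary segment for indices that do not describe a cell.
    · exact ⟨Piece.seg ⟨0, EuclideanSpace.single 0 1, by
        intro h; simpa using congrArg (fun x : Plane => x 0) h⟩, fun h1 h2 => (h ⟨h1, h2⟩).elim⟩
  choose piece hpiece using hpiece
  let I : Set (Set Plane × ℝ × ℝ) := {q | q.1 ∈ G ∧
    IsCell (γ q.1) (a q.1) (b q.1) V q.2.1 q.2.2 ∧ γ q.1 '' Icc q.2.1 q.2.2 ⊆ frontier X}
  have hIfin : I.Finite := by
    refine (hG.biUnion fun k hk => ((hγ k hk).finite_cells hVfin).image (Prod.mk k)).subset ?_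
    rintro ⟨k, q⟩ ⟨h1, h2, -⟩
    exact mem_biUnion h1 ⟨q, h2, rfl⟩
  have hcar : ∀ q ∈ I, (piece q).carrier = γ q.1 '' Icc q.2.1 q.2.2 := fun q hq =>
    (hpiece q hq.1 hq.2.1).2.1
  have hend : ∀ q ∈ I, ∀ x ∈ (piece q).carrier, x ∈ V → x ∈ (piece q).endpoints := by
    intro q hq x hx hxV
    rw [hcar q hq] at hx
    obtain ⟨u, hu, rfl⟩ := hx
    rw [(hpiece q hq.1 hq.2.1).2.2]
    rcases hq.2.1.eq_or_eq hu hxV with rfl | rfl <;> simp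
  refine ⟨piece '' I, ⟨hX, hIfin.image _, ?_, ?_⟩, ?_⟩
  · apply Subset.antisymm
    · have hclosed : IsClosed (⋃ p ∈ piece '' I, p.carrier) := by
        rw [biUnion_image]
        refine hIfin.isClosed_biUnion fun q hq => ?_
        rw [hcar q hq]
        exact (isCompact_Icc.image (hγ q.1 hq.1).continuous).isClosed
      have hoff : frontier X \ V ⊆ ⋃ p ∈ piece '' I, p.carrier := by
        rintro x ⟨hx, hxV⟩
        obtain ⟨k, hk, hxk⟩ := hfr hx
        obtain ⟨u, hu, rfl⟩ := hcov k hk ⟨hxk, hx⟩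
        obtain ⟨s, t, hst, hust⟩ := (hγ k hk).exists_cell hVfin (hVa k hk) (hVb k hk) hu hxV
        have hq : (k, s, t) ∈ I := ⟨hk, hst, hcell k hk s t hst u hust hx⟩
        refine mem_biUnion (mem_image_of_mem piece hq) ?_
        rw [hcar _ hq]
        exact mem_image_of_mem _ (Ioo_subset_Icc_self hust)
      intro x hx
      -- No frontier point is isolated and `V` is finite, so vertices in the frontier are limits of
      -- frontier points outside `V`.
      refine closure_minimal hoff hclosed (mem_closure_iff_nhds.2 fun U hU => ?_)
      have hW : (V \ {x})ᶜ ∈ 𝓝 x := (hVfin.sdiff).isClosed.isOpen_compl.mem_nhds (by simp)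
      obtain ⟨y, ⟨hyU, hyW⟩, hyX, hyx⟩ :=
        mem_closure_iff_nhds.1 (hacc x hx) _ (inter_mem hU hW)
      exact ⟨y, hyU, hyX, fun hyV => hyW ⟨hyV, hyx⟩⟩
    · rw [biUnion_image]
      exact iUnion₂_subset fun q hq => (hcar q hq).subset.trans hq.2.2
  · rintro _ ⟨q, hq, rfl⟩ _ ⟨q', hq', rfl⟩ hne x ⟨hx, hx'⟩
    by_cases hxV : x ∈ V
    · exact ⟨hend q hq x hx hxV, hend q' hq' x hx' hxV⟩
    · refine (hne ?_).elim
      rw [hcar q hq] at hx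
      rw [hcar q' hq'] at hx'
      obtain ⟨u, hu, rfl⟩ := hx
      obtain ⟨u', hu', huu⟩ := hx'
      have hk : q.1 = q'.1 := by
        by_contra hk
        exact hxV (hVpair _ hq.1 _ hq'.1 hk ⟨(hγ _ hq.1).mem u, huu ▸ (hγ _ hq'.1).mem u'⟩)
      obtain ⟨k, s, t⟩ := q
      obtain ⟨k', s', t'⟩ := q'
      obtain rfl : k = k' := hk
      have h1 := hq.2.1.mem_Ioo hu hxV
      have h2 := hq'.2.1.mem_Ioo hu' (by rwa [huu])
      obtain rfl : u' = u := (hγ k hq.1).inj _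
        ⟨hq'.2.1.le_left.trans_lt h2.1, h2.2.trans_le hq'.2.1.le_right⟩ _
        ⟨hq.2.1.le_left.trans_lt h1.1, h1.2.trans_le hq.2.1.le_right⟩ huu
      obtain ⟨h3, h4⟩ := hq.2.1.unique hq'.2.1 h1 h2
      simp only at h3 h4
      rw [h3, h4]
  · rintro _ ⟨q, hq, rfl⟩
    exact (hpiece q hq.1 hq.2.1).1

/-! ### Lines and their intersections with lines and circles -/

theorem inner_eq (x y : Plane) : inner ℝ x y = x 0 * y 0 + x 1 * y 1 := by
  simp [PiLp.inner_apply, Fin.sum_univ_two, mul_comm]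

theorem ext_plane {x y : Plane} (h0 : x 0 = y 0) (h1 : x 1 = y 1) : x = y := by
  ext i; fin_cases i <;> assumption

/-- Rotation by a right angle. -/
noncomputable def rot (x : Plane) : Plane := !₂[-x 1, x 0]

@[simp] theorem rot_zero (x : Plane) : rot x 0 = -x 1 := rfl

@[simp] theorem rot_one (x : Plane) : rot x 1 = x 0 := rfl

theorem sq_add_sq_ne_zero {x : Plane} (hx : x ≠ 0) : x 0 ^ 2 + x 1 ^ 2 ≠ 0 := by
  intro h
  refine hx (ext_plane ?_ ?_) <;> simp <;> nlinarith [sq_nonneg (x 0), sq_nonneg (x 1)]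

theorem rot_ne_zero {x : Plane} (hx : x ≠ 0) : rot x ≠ 0 := by
  intro h
  refine hx (ext_plane ?_ ?_)
  · simpa using congrArg (fun y : Plane => y 1) h
  · simpa using congrArg (fun y : Plane => y 0) h

theorem norm_rot (x : Plane) : ‖rot x‖ = ‖x‖ := by
  rw [← sq_eq_sq₀ (norm_nonneg _) (norm_nonneg _), ← real_inner_self_eq_norm_sq,
    ← real_inner_self_eq_norm_sq, inner_eq, inner_eq]
  simp; ring

theorem exists_smul_of_inner_rot {e y : Plane} (he : e ≠ 0) (h : inner ℝ (rot e) y = 0) :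
    y = (inner ℝ e y / inner ℝ e e) • e := by
  have h2 := sq_add_sq_ne_zero he
  simp only [inner_eq, rot_zero, rot_one] at h ⊢
  refine ext_plane ?_ ?_ <;> simp only [PiLp.smul_apply, smul_eq_mul] <;>
    rw [div_mul_eq_mul_div, eq_div_iff (by simpa only [sq] using h2)]
  · linear_combination (-e 1) * h
  · linear_combination (e 0) * h

/-- A straight line, given by a normal equation. -/
def IsLine (k : Set Plane) : Prop := ∃ n : Plane, n ≠ 0 ∧ ∃ d : ℝ, k = {x | inner ℝ n x - d = 0}

/-- The line through the two endpoints of a segment. -/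
def LineSegment.line (s : LineSegment) : Set Plane :=
  {x | inner ℝ (rot (s.target - s.source)) x - inner ℝ (rot (s.target - s.source)) s.source = 0}

theorem LineSegment.isLine (s : LineSegment) : IsLine s.line :=
  ⟨_, rot_ne_zero (sub_ne_zero.2 s.source_ne_target.symm), _, rfl⟩

theorem inner_rot_self (x : Plane) : inner ℝ (rot x) x = 0 := by
  simp [inner_eq]; ring

theorem LineSegment.carrier_subset_line (s : LineSegment) :
    segment ℝ s.source s.target ⊆ s.line := by
  rw [segment_eq_image']
  rintro _ ⟨t, -, rfl⟩
  simp only [line, mem_ofPred_eq, inner_add_right, inner_smul_right, inner_rot_self]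
  ring

/-- A point of the open segment has a neighbourhood in its line that lies in the segment. -/
theorem LineSegment.eventually_mem_carrier (s : LineSegment) {p : Plane}
    (hp : p ∈ segment ℝ s.source s.target) (h1 : p ≠ s.source) (h2 : p ≠ s.target) :
    ∀ᶠ y in 𝓝[s.line] p, y ∈ segment ℝ s.source s.target := by
  set e := s.target - s.source with he
  have he0 : e ≠ 0 := sub_ne_zero.2 s.source_ne_target.symm
  have hee : inner ℝ e e ≠ 0 := inner_self_ne_zero.2 he0
  have hcont : Continuous fun y : Plane => inner ℝ e (y - s.source) / inner ℝ e e := by fun_prop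
  rw [segment_eq_image'] at hp ⊢
  obtain ⟨t, ht, rfl⟩ := hp
  rw [← he]
  have ht0 : t ≠ 0 := by rintro rfl; simp at h1
  have ht1 : t ≠ 1 := by rintro rfl; exact h2 (by simp)
  have hval : inner ℝ e (s.source + t • e - s.source) / inner ℝ e e = t := by
    rw [add_sub_cancel_left, inner_smul_right, mul_div_assoc, div_self hee, mul_one]
  have hev : ∀ᶠ y in 𝓝 (s.source + t • e), inner ℝ e (y - s.source) / inner ℝ e e ∈ Ioo 0 1 := by
    refine hcont.continuousAt.eventually_mem ?_
    rw [hval]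
    exact Ioo_mem_nhds (lt_of_le_of_ne ht.1 ht0.symm) (lt_of_le_of_ne ht.2 ht1)
  filter_upwards [self_mem_nhdsWithin, mem_nhdsWithin_of_mem_nhds hev] with y hy hy2
  refine ⟨_, Ioo_subset_Icc_self hy2, ?_⟩
  simp only [line, mem_ofPred_eq, ← inner_sub_right] at hy
  simp only
  rw [← exists_smul_of_inner_rot he0 hy, add_sub_cancel]

theorem IsLine.exists_param {k : Set Plane} (h : IsLine k) :
    ∃ p q : Plane, p ≠ q ∧ k = range (AffineMap.lineMap p q : ℝ →ᵃ[ℝ] Plane) := by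
  obtain ⟨n, hn, d, rfl⟩ := h
  have hnn : inner ℝ n n ≠ 0 := inner_self_ne_zero.2 hn
  refine ⟨(d / inner ℝ n n) • n, (d / inner ℝ n n) • n + rot n, ?_, ?_⟩
  · simpa using rot_ne_zero hn
  · ext x
    simp only [mem_ofPred_eq, mem_range, AffineMap.lineMap_apply_module', add_sub_cancel_left]
    constructor
    · intro hx
      have h1 : inner ℝ (rot (rot n)) (x - (d / inner ℝ n n) • n) = 0 := by
        have : rot (rot n) = -n := ext_plane (by simp) (by simp)
        rw [this, inner_neg_left, inner_sub_right, inner_smul_right, div_mul_cancel₀ _ hnn, hx,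
          neg_zero]
      have := exists_smul_of_inner_rot (rot_ne_zero hn) h1
      exact ⟨_, by rw [← this]; abel⟩
    · rintro ⟨t, rfl⟩
      rw [inner_add_right, inner_smul_right, inner_smul_right, div_mul_cancel₀ _ hnn,
        real_inner_comm, inner_rot_self]
      ring

theorem IsLine.isClosed {k : Set Plane} (h : IsLine k) : IsClosed k := by
  obtain ⟨n, -, d, rfl⟩ := h
  exact isClosed_eq (by fun_prop) continuous_const

/-- A normal vector is orthogonal to `y - x`, which determines it up to a nonzero factor; the point
`x` then fixes the equation. -/
theorem IsLine.eq_of_mem {k l : Set Plane} (hk : IsLine k) (hl : IsLine l) {x y : Plane}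
    (hxy : x ≠ y) (hxk : x ∈ k) (hyk : y ∈ k) (hxl : x ∈ l) (hyl : y ∈ l) : k = l := by
  have key : ∀ {k : Set Plane}, IsLine k → x ∈ k → y ∈ k →
      k = {z | inner ℝ (rot (y - x)) z - inner ℝ (rot (y - x)) x = 0} := by
    rintro _ ⟨n, hn, d, rfl⟩ hx hy
    simp only [mem_ofPred_eq] at hx hy
    have h1 : inner ℝ (rot (rot (y - x))) n = 0 := by
      have : rot (rot (y - x)) = x - y := ext_plane (by simp) (by simp)
      rw [this, real_inner_comm, inner_sub_right]; linarith
    have h2 := exists_smul_of_inner_rot (rot_ne_zero (sub_ne_zero.2 hxy.symm)) h1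
    set c := inner ℝ (rot (y - x)) n / inner ℝ (rot (y - x)) (rot (y - x))
    have hc : c ≠ 0 := by rintro h; rw [h, zero_smul] at h2; exact hn h2
    ext z
    simp only [mem_ofPred_eq]
    have : inner ℝ n z - d = c * (inner ℝ (rot (y - x)) z - inner ℝ (rot (y - x)) x) := by
      rw [mul_sub, ← real_inner_smul_left, ← real_inner_smul_left, ← h2]; linarith
    rw [this, mul_eq_zero, or_iff_right hc]
  rw [key hk hxk hyk, key hl hxl hyl]

theorem IsLine.finite_inter {k l : Set Plane} (hk : IsLine k) (hl : IsLine l) (hkl : k ≠ l) :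
    (k ∩ l).Finite := by
  refine Set.Subsingleton.finite fun x hx y hy => ?_
  by_contra hxy
  exact hkl (hk.eq_of_mem hl hxy hx.1 hy.1 hx.2 hy.2)

theorem IsLine.finite_inter_sphere {k : Set Plane} (hk : IsLine k) (c : Plane) (r : ℝ) :
    (k ∩ sphere c r).Finite := by
  obtain ⟨p, q, hpq, rfl⟩ := hk.exists_param
  set e := q - p with he
  have hee : inner ℝ e e ≠ 0 := inner_self_ne_zero.2 (sub_ne_zero.2 hpq.symm)
  have hfin : {t : ℝ | dist (AffineMap.lineMap p q t) c = r}.Finite := by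
    rcases Set.eq_empty_or_nonempty {t : ℝ | dist (AffineMap.lineMap p q t) c = r} with h | ⟨t₁, ht₁⟩
    · rw [h]; exact finite_empty
    -- Along the line the squared distance from `c` is a quadratic polynomial in `t`, and Vieta's
    -- formula for the sum of the roots gives the second one.
    refine (toFinite {t₁, -2 * inner ℝ e (p - c) / inner ℝ e e - t₁}).subset fun t ht => ?_
    have expand : ∀ t : ℝ, dist (AffineMap.lineMap p q t) c = r →
        t ^ 2 * inner ℝ e e + 2 * t * inner ℝ e (p - c) + inner ℝ (p - c) (p - c) = r ^ 2 := by
      intro t ht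
      rw [← ht, dist_eq_norm, ← real_inner_self_eq_norm_sq, AffineMap.lineMap_apply_module', ← he]
      simp only [inner_eq, PiLp.sub_apply, PiLp.add_apply, PiLp.smul_apply, smul_eq_mul]
      ring
    have h1 := expand t₁ ht₁
    have h2 := expand t ht
    by_cases h : t = t₁
    · exact Or.inl h
    · right
      have h3 : (t - t₁) * ((t + t₁) * inner ℝ e e + 2 * inner ℝ e (p - c)) = 0 := by
        linear_combination h2 - h1
      have h4 := (mul_eq_zero.1 h3).resolve_left (sub_ne_zero.2 h)
      simp only [mem_singleton_iff]
      rw [eq_sub_iff_add_eq, eq_div_iff hee]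
      linarith
  refine (hfin.image (AffineMap.lineMap p q)).subset ?_
  rintro _ ⟨⟨t, rfl⟩, ht⟩
  exact ⟨t, ht, rfl⟩

/-- The difference of the two circle equations describes the perpendicular bisector of the centers,
a line. -/
theorem finite_sphere_inter_sphere {c c' : Plane} (h : c ≠ c') (r : ℝ) :
    (sphere c r ∩ sphere c' r).Finite := by
  have hl : IsLine {x | inner ℝ (c' - c) x - (inner ℝ c' c' - inner ℝ c c) / 2 = 0} :=
    ⟨_, sub_ne_zero.2 h.symm, _, rfl⟩
  refine (hl.finite_inter_sphere c r).subset fun x ⟨hx, hx'⟩ => ⟨?_, hx⟩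
  have h1 : dist x c ^ 2 = dist x c' ^ 2 := by rw [mem_sphere.1 hx, mem_sphere.1 hx']
  rw [dist_eq_norm, dist_eq_norm, ← real_inner_self_eq_norm_sq, ← real_inner_self_eq_norm_sq] at h1
  simp only [mem_ofPred_eq, inner_eq, PiLp.sub_apply] at h1 ⊢
  linarith

/-! ### Parametrized circles -/

/-- The unit vector at angle `θ`. -/
noncomputable def unit (θ : ℝ) : Plane := !₂[Real.cos θ, Real.sin θ]

@[simp] theorem unit_zero (θ : ℝ) : unit θ 0 = Real.cos θ := rfl

@[simp] theorem unit_one (θ : ℝ) : unit θ 1 = Real.sin θ := rfl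

theorem inner_unit_self (θ : ℝ) : inner ℝ (unit θ) (unit θ) = 1 := by
  simp only [inner_eq, unit_zero, unit_one]
  linarith [Real.cos_sq_add_sin_sq θ]

@[simp] theorem norm_unit (θ : ℝ) : ‖unit θ‖ = 1 := by
  have := inner_unit_self θ
  rw [real_inner_self_eq_norm_sq] at this
  nlinarith [norm_nonneg (unit θ)]

theorem continuous_unit : Continuous unit := by
  unfold unit
  fun_prop

theorem circlePoint_eq (c : Plane) (ρ θ : ℝ) : circlePoint c ρ θ = c + ρ • unit θ := rfl

theorem continuous_circlePoint (c : Plane) (ρ : ℝ) : Continuous (circlePoint c ρ) := by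
  have := continuous_unit
  simp only [funext (circlePoint_eq c ρ)]
  fun_prop

theorem dist_circlePoint {c : Plane} {ρ : ℝ} (hρ : 0 ≤ ρ) (θ : ℝ) :
    dist (circlePoint c ρ θ) c = ρ := by
  simp [circlePoint_eq, norm_smul, abs_of_nonneg hρ]

theorem circlePoint_inj {c : Plane} {ρ : ℝ} (hρ : 0 < ρ) {s t : ℝ}
    (h : circlePoint c ρ s = circlePoint c ρ t) : ∃ n : ℤ, s - t = 2 * Real.pi * n := by
  have hu : unit s = unit t := smul_right_injective Plane hρ.ne' (add_left_cancel h)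
  exact Real.Angle.angle_eq_iff_two_pi_dvd_sub.1 (Real.Angle.cos_sin_inj
    (congrArg (fun x : Plane => x 0) hu) (congrArg (fun x : Plane => x 1) hu))

theorem eq_of_circlePoint_eq {c : Plane} {ρ : ℝ} (hρ : 0 < ρ) {s t : ℝ}
    (h : circlePoint c ρ s = circlePoint c ρ t) (hst : |s - t| < 2 * Real.pi) : s = t := by
  obtain ⟨n, hn⟩ := circlePoint_inj hρ h
  have hn0 : n = 0 := by
    by_contra hne
    have : (1 : ℝ) ≤ |(n : ℝ)| := by exact_mod_cast Int.one_le_abs hne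
    rw [hn, abs_mul, abs_of_pos Real.two_pi_pos] at hst
    nlinarith [Real.two_pi_pos]
  rw [hn0] at hn
  simpa [sub_eq_zero] using hn

theorem exists_circlePoint {c x : Plane} {r : ℝ} (hx : dist x c = r) :
    ∃ θ ∈ Icc 0 (2 * Real.pi), circlePoint c r θ = x := by
  let z : ℂ := ⟨(x - c) 0, (x - c) 1⟩
  have hz : ‖z‖ = r := by
    rw [← hx, dist_eq_norm, ← sq_eq_sq₀ (norm_nonneg _) (norm_nonneg _), Complex.sq_norm,
      Complex.normSq_apply, ← real_inner_self_eq_norm_sq, inner_eq]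
  refine ⟨toIcoMod Real.two_pi_pos 0 z.arg, ?_, ?_⟩
  · have := toIcoMod_mem_Ico Real.two_pi_pos 0 z.arg
    rw [zero_add] at this
    exact Ico_subset_Icc_self this
  · have h1 : toIcoMod Real.two_pi_pos 0 z.arg =
      z.arg - toIcoDiv Real.two_pi_pos 0 z.arg * (2 * Real.pi) := by
      rw [toIcoMod, zsmul_eq_mul]
    have h2 := Complex.norm_mul_cos_arg z
    have h3 := Complex.norm_mul_sin_arg z
    rw [hz] at h2 h3
    refine ext_plane ?_ ?_
    · simp only [circlePoint_eq, PiLp.add_apply, PiLp.smul_apply, unit_zero, smul_eq_mul, h1,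
        Real.cos_sub_int_mul_two_pi, h2]
      simp [z]
    · simp only [circlePoint_eq, PiLp.add_apply, PiLp.smul_apply, unit_one, smul_eq_mul, h1,
        Real.sin_sub_int_mul_two_pi, h3]
      simp [z]

/-- A segment, or an arc of radius `r` with its center in `C`. -/
def IsSegOrArc (C : Set Plane) (r : ℝ) (p : Piece) : Prop :=
  (∃ s, p = Piece.seg s) ∨ ∃ γ, p = Piece.arc γ ∧ γ.center ∈ C ∧ γ.radius = r

theorem isCurve_circlePoint {C : Set Plane} {c : Plane} (hc : c ∈ C) {r : ℝ} (hr : 0 < r) :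
    IsCurve (IsSegOrArc C r) (sphere c r) (circlePoint c r) 0 (2 * Real.pi) where
  lt := Real.two_pi_pos
  continuous := continuous_circlePoint c r
  mem t := dist_circlePoint hr.le t
  inj s hs t ht h := eq_of_circlePoint_eq hr h (by
    rw [abs_lt]; constructor <;> linarith [hs.1, hs.2, ht.1, ht.2])
  sub s t hs hst ht := ⟨Piece.arc ⟨c, r, s, t, hr, hst, by linarith⟩,
    Or.inr ⟨_, rfl, hc, rfl⟩, rfl, rfl⟩

theorem isCurve_lineMap {C : Set Plane} {r : ℝ} {p q : Plane} (hpq : p ≠ q) {a b : ℝ}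
    (hab : a < b) : IsCurve (IsSegOrArc C r) (range (AffineMap.lineMap p q : ℝ →ᵃ[ℝ] Plane))
      (AffineMap.lineMap p q) a b where
  lt := hab
  continuous := AffineMap.lineMap_continuous
  mem t := mem_range_self t
  inj s _ t _ h := AffineMap.lineMap_injective ℝ hpq h
  sub s t _ hst _ := ⟨Piece.seg ⟨AffineMap.lineMap p q s, AffineMap.lineMap p q t,
    fun h => hst.ne (AffineMap.lineMap_injective ℝ hpq h)⟩, Or.inl ⟨_, rfl⟩, by
      rw [Piece.carrier, ← image_segment, segment_eq_Icc hst.le], rfl⟩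

/-! ### Decomposition of frontiers into segments and arcs -/

/-- A closed set whose frontier lies in finitely many lines and circles and which is, up to
finitely many segments, the closure of its interior, has a boundary that consists of finitely
many segments and arcs of these circles. -/
theorem exists_boundaryConsistsOf_isSegOrArc {X : Set Plane} (hX : IsClosed X)
    (hbdd : Bornology.IsBounded (frontier X)) {C : Set Plane} {r : ℝ} (hr : 0 < r)
    {G : Set (Set Plane)} (hG : G.Finite) (hGk : ∀ k ∈ G, IsLine k ∨ ∃ c ∈ C, k = sphere c r)
    (hfr : frontier X ⊆ ⋃₀ G) {S : Set LineSegment} (hS : S.Finite)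
    (hSG : ∀ s ∈ S, s.line ∈ G) (hSX : ∀ s ∈ S, segment ℝ s.source s.target ⊆ X)
    (hXS : X ⊆ closure (interior X) ∪ ⋃ s ∈ S, segment ℝ s.source s.target) :
    ∃ F : Set Piece, BoundaryConsistsOf X F ∧ ∀ p ∈ F, IsSegOrArc C r p := by
  have hclosed : ∀ k ∈ G, IsClosed k := by
    intro k hk
    rcases hGk k hk with h | ⟨c, -, rfl⟩
    exacts [h.isClosed, isClosed_sphere]
  have hsep : ∀ k ∈ G, ∃ f : Plane → ℝ, LocallySeparates f ∧ k = {x | f x = 0} := by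
    intro k hk
    rcases hGk k hk with ⟨n, hn, d, rfl⟩ | ⟨c, -, rfl⟩
    · exact ⟨_, locallySeparates_inner n hn d, rfl⟩
    · exact ⟨_, locallySeparates_dist c hr, by ext x; simp [sub_eq_zero, dist_eq_norm]⟩
  refine exists_boundaryConsistsOf hX hG ?_ ?_ hfr
    (V₀ := ⋃ s ∈ S, {s.source, s.target}) (hS.biUnion fun _ _ => toFinite _) ?_ ?_
  · intro k hk
    rcases hGk k hk with h | ⟨c, hc, rfl⟩
    · obtain ⟨p, q, hpq, rfl⟩ := h.exists_param
      obtain ⟨M, hM⟩ := hbdd.subset_closedBall p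
      -- The added `1` keeps the parameter interval nondegenerate even if the bound `M` is zero.
      refine ⟨AffineMap.lineMap p q, -(|M| / dist p q + 1), |M| / dist p q + 1,
        isCurve_lineMap hpq (by have : 0 ≤ |M| / dist p q := by positivity
                                linarith), ?_⟩
      rintro _ ⟨⟨t, rfl⟩, ht⟩
      refine mem_image_of_mem _ (abs_le.1 ?_)
      have h1 := hM ht
      rw [mem_closedBall, dist_lineMap_left, Real.norm_eq_abs] at h1
      have h2 : |t| ≤ |M| / dist p q := by
        rw [le_div_iff₀ (dist_pos.2 hpq)]; exact h1.trans (le_abs_self M)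
      linarith
    · refine ⟨_, _, _, isCurve_circlePoint hc hr, ?_⟩
      rintro x ⟨hx, -⟩
      exact exists_circlePoint hx
  · intro k hk l hl hkl
    rcases hGk k hk with h | ⟨c, -, rfl⟩ <;> rcases hGk l hl with h' | ⟨c', -, rfl⟩
    · exact h.finite_inter h' hkl
    · exact h.finite_inter_sphere c' r
    · rw [inter_comm]; exact h'.finite_inter_sphere c r
    · exact finite_sphere_inter_sphere (fun h => hkl (by rw [h])) r
  · intro k hk p hpk hp hpV hother
    by_cases hpi : p ∈ closure (interior X)
    · obtain ⟨f, hf, rfl⟩ := hsep k hk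
      refine hf.eventually_mem_frontier hX hpk hp hpi ?_
      -- The other curves are closed and miss `p`, so near `p` the frontier lies on this curve
      -- alone.
      have hcl : IsClosed (⋃ l ∈ G \ {{x | f x = 0}}, l) :=
        hG.sdiff.isClosed_biUnion fun l hl => hclosed l hl.1
      have hp' : p ∉ ⋃ l ∈ G \ {{x | f x = 0}}, l := by
        simp only [mem_iUnion, not_exists]
        exact fun l hl => hother l hl.1 hl.2
      filter_upwards [hcl.isOpen_compl.mem_nhds hp'] with y hy hyX
      obtain ⟨l, hl, hyl⟩ := hfr hyX
      by_contra hne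
      exact hy (mem_biUnion (show l ∈ G \ {{x | f x = 0}} from
        ⟨hl, fun h => hne (by rw [h] at hyl; exact hyl)⟩) hyl)
    -- Here `p` is an inner point of a one-dimensional part: nearby points of the segment are in `X`
    -- but are not limits of interior points.
    · obtain ⟨s, hs, hps⟩ : ∃ s ∈ S, p ∈ segment ℝ s.source s.target := by
        simpa using (hXS (hX.frontier_subset hp)).resolve_left hpi
      have hline : s.line = k := by
        by_contra hne
        exact hother _ (hSG s hs) hne (s.carrier_subset_line hps)
      have hends : p ≠ s.source ∧ p ≠ s.target := by
        constructor <;> rintro rfl <;> exact hpV (mem_biUnion hs (by simp))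
      filter_upwards [hline ▸ s.eventually_mem_carrier hps hends.1 hends.2,
        mem_nhdsWithin_of_mem_nhds (isClosed_closure.isOpen_compl.mem_nhds hpi)] with y hy hyi
      exact ⟨subset_closure (hSX s hs hy), fun h => hyi (subset_closure h)⟩
  · intro v hv
    refine mem_closure_frontier_diff hX hv ?_
    rcases hXS (hX.frontier_subset hv) with hvi | hvs
    · rw [mem_closure_iff_nhds] at hvi ⊢
      intro U hU
      obtain ⟨W, hWU, hW, hvW⟩ := _root_.mem_nhds_iff.1 hU
      obtain ⟨y, hyW, hyX⟩ := hvi W (hW.mem_nhds hvW)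
      have hne : (W ∩ interior X).Nontrivial := by
        by_contra h
        rw [not_nontrivial_iff] at h
        have := h.eq_singleton_of_mem ⟨hyW, hyX⟩
        exact not_isOpen_singleton y (this ▸ hW.inter isOpen_interior)
      obtain ⟨z, hz, hzv⟩ := hne.exists_ne v
      exact ⟨z, hWU hz.1, interior_subset hz.2, hzv⟩
    · obtain ⟨s, hs, hvs⟩ : ∃ s ∈ S, v ∈ segment ℝ s.source s.target := by simpa using hvs
      have hpre := (convex_segment (𝕜 := ℝ) s.source s.target).isPreconnected.preperfect_of_nontrivial
        ⟨_, left_mem_segment ℝ _ _, _, right_mem_segment ℝ _ _, s.source_ne_target⟩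
      exact closure_mono (sdiff_subset_sdiff_left (hSX s hs))
        (accPt_iff_nhds.1 (hpre v hvs) |> fun h => mem_closure_iff_nhds.2 fun U hU => by
          obtain ⟨y, ⟨hyU, hys⟩, hyv⟩ := h U hU
          exact ⟨y, hyU, hys, hyv⟩)

/-! ### Dents and nearest points -/

theorem CircularArc.isCompact_carrier (γ : CircularArc) : IsCompact γ.carrier :=
  isCompact_Icc.image (continuous_circlePoint _ _)

theorem isCompact_segment (x y : Plane) : IsCompact (segment ℝ x y) := by
  rw [segment_eq_image_lineMap]
  exact isCompact_Icc.image AffineMap.lineMap_continuous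

theorem Piece.isCompact_carrier (p : Piece) : IsCompact p.carrier := by
  cases p with
  | seg s => exact isCompact_segment _ _
  | arc γ => exact γ.isCompact_carrier

theorem Piece.endpoints_subset_carrier (p : Piece) : p.endpoints ⊆ p.carrier := by
  cases p with
  | seg s =>
    rintro x (rfl | rfl)
    exacts [left_mem_segment ℝ _ _, right_mem_segment ℝ _ _]
  | arc γ =>
    rintro x (rfl | rfl)
    exacts [⟨_, ⟨le_rfl, γ.start_lt_end.le⟩, rfl⟩, ⟨_, ⟨γ.start_lt_end.le, le_rfl⟩, rfl⟩]

theorem Piece.finite_endpoints (p : Piece) : p.endpoints.Finite := by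
  cases p with
  | seg s => exact toFinite {s.source, s.target}
  | arc γ => exact toFinite {circlePoint _ _ _, circlePoint _ _ _}

theorem BoundaryConsistsOf.carrier_subset_frontier {P : Set Plane} {F : Set Piece}
    (hB : BoundaryConsistsOf P F) {p : Piece} (hp : p ∈ F) : p.carrier ⊆ frontier P := by
  rw [hB.frontier_eq]
  exact subset_biUnion_of_mem hp

theorem BoundaryConsistsOf.carrier_subset {P : Set Plane} {F : Set Piece}
    (hB : BoundaryConsistsOf P F) {p : Piece} (hp : p ∈ F) : p.carrier ⊆ P :=
  (hB.carrier_subset_frontier hp).trans hB.isClosed.frontier_subset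

theorem BoundaryConsistsOf.isCompact_frontier {P : Set Plane} {F : Set Piece}
    (hB : BoundaryConsistsOf P F) : IsCompact (frontier P) := by
  rw [hB.frontier_eq]
  exact hB.finite.isCompact_biUnion fun p _ => p.isCompact_carrier

theorem CircularArc.notMem_endpoints (γ : CircularArc) {θ : ℝ}
    (hθ : θ ∈ Ioo γ.startAngle γ.endAngle) :
    circlePoint γ.center γ.radius θ ∉ (Piece.arc γ).endpoints := by
  have := γ.end_le
  rintro (h | h)
  · exact hθ.1.ne' (eq_of_circlePoint_eq γ.radius_pos h (by
      rw [abs_lt]; constructor <;> linarith [hθ.1, hθ.2]))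
  · exact hθ.2.ne (eq_of_circlePoint_eq γ.radius_pos h (by
      rw [abs_lt]; constructor <;> linarith [hθ.1, hθ.2]))

/-- Near an inner point of a dent, the outside of its circle belongs to the region. -/
theorem exists_ball_inter_subset_interior {P : Set Plane} {F : Set Piece}
    (hB : BoundaryConsistsOf P F) {γ : CircularArc} (hγF : Piece.arc γ ∈ F)
    (hdent : IsDent P γ) (hint : γ.carrier ⊆ closure (interior P)) {θ : ℝ}
    (hθ : θ ∈ Ioo γ.startAngle γ.endAngle) :
    ∃ δ > 0, ball (circlePoint γ.center γ.radius θ) δ ∩ {x | γ.radius < dist x γ.center} ⊆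
      interior P := by
  obtain ⟨p, hp⟩ : ∃ p, circlePoint γ.center γ.radius θ = p := ⟨_, rfl⟩
  have hr := γ.radius_pos
  have hf := locallySeparates_dist γ.center hr
  have hsphere : ∀ x ∈ γ.carrier, dist x γ.center = γ.radius := by
    rintro _ ⟨t, -, rfl⟩
    exact dist_circlePoint hr.le t
  have hpγ : p ∈ γ.carrier := ⟨θ, Ioo_subset_Icc_self hθ, hp⟩
  have hp0 : dist p γ.center - γ.radius = 0 := sub_eq_zero.2 (hsphere p hpγ)
  -- By `linked`, an inner point of the arc is on no other piece, so the frontier near `p` is part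
  -- of this arc.
  obtain ⟨ε, hε, hεF⟩ : ∃ ε > 0, ball p ε ∩ frontier P ⊆ γ.carrier := by
    have hcl : IsClosed (⋃ q ∈ F \ {Piece.arc γ}, q.carrier) :=
      hB.finite.sdiff.isClosed_biUnion fun q _ => q.isCompact_carrier.isClosed
    have hpn : p ∉ ⋃ q ∈ F \ {Piece.arc γ}, q.carrier := by
      simp only [mem_iUnion, not_exists]
      intro q hq hpq
      exact γ.notMem_endpoints hθ
        (hp ▸ (hB.linked _ hγF q hq.1 (fun h => hq.2 h.symm) ⟨hpγ, hpq⟩).1)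
    obtain ⟨ε, hε, h⟩ := Metric.mem_nhds_iff.1 (hcl.isOpen_compl.mem_nhds hpn)
    refine ⟨ε, hε, fun y ⟨hy, hyP⟩ => ?_⟩
    rw [hB.frontier_eq] at hyP
    obtain ⟨q, hq, hyq⟩ := mem_iUnion₂.1 hyP
    by_cases hqγ : q = Piece.arc γ
    · subst hqγ; exact hyq
    · exact (h hy (mem_biUnion (show q ∈ F \ {Piece.arc γ} from ⟨hq, hqγ⟩) hyq)).elim
  obtain ⟨δ₁, hδ₁, S, hS, hSε, hSδ⟩ := hf.pos_side p hp0 ε hε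
  obtain ⟨δ₂, hδ₂, T, hT, hTε, hTδ⟩ := hf.neg_side p hp0 ε hε
  have hSd := subset_interior_or_subset_compl (X := P) hS (disjoint_left.2 fun x hx hx2 =>
    (hSε hx).2.ne' (sub_eq_zero.2 (hsphere x (hεF ⟨(hSε hx).1, hx2⟩))))
  have hTd := subset_interior_or_subset_compl (X := P) hT (disjoint_left.2 fun x hx hx2 =>
    (hTε hx).2.ne (sub_eq_zero.2 (hsphere x (hεF ⟨(hTε hx).1, hx2⟩))))
  rw [hp]
  rcases hSd with hSi | hSc
  · exact ⟨δ₁, hδ₁, fun x hx => hSi (hSδ ⟨hx.1, by rw [mem_ofPred_eq]; exact sub_pos.2 hx.2⟩)⟩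
  -- If the outside is disjoint from `P` near `p`, the inside belongs to `P`, since `p` is a limit
  -- of interior points. A short chord, strictly inside the circle except for its ends, then
  -- contradicts `hdent`.
  exfalso
  have hSi : ∀ y ∈ interior P, y ∉ S := fun y hy hyS =>
    hSc hyS (subset_closure (interior_subset hy))
  have hTi : T ⊆ interior P := by
    refine hTd.resolve_right fun hTc => ?_
    obtain ⟨y, ⟨hy1, hy2⟩, hyi⟩ := mem_closure_iff_nhds.1 (hint hpγ) _
      (inter_mem (ball_mem_nhds p hδ₁) (ball_mem_nhds p hδ₂))
    rcases lt_trichotomy (dist y γ.center - γ.radius) 0 with h | h | h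
    · exact hTc (hTδ ⟨hy2, h⟩) (subset_closure (interior_subset hyi))
    · obtain ⟨z, ⟨hz1, hz2⟩, hz3⟩ := mem_closure_iff.1 (hf.mem_closure_pos y h)
        _ (isOpen_ball.inter isOpen_interior) ⟨hy1, hyi⟩
      exact hSi z hz2 (hSδ ⟨hz1, hz3⟩)
    · exact hSi y hyi (hSδ ⟨hy1, h⟩)
  have hnear : ∀ᶠ t in 𝓝 θ, circlePoint γ.center γ.radius t ∈ ball p δ₂ ∧
      t ∈ Icc γ.startAngle γ.endAngle :=
    ((continuous_circlePoint _ _).continuousAt.eventually_mem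
      (by rw [hp]; exact ball_mem_nhds p hδ₂)).and (Icc_mem_nhds hθ.1 hθ.2)
  obtain ⟨η, hη, hηs⟩ := Metric.eventually_nhds_iff.1 hnear
  -- The bound `h < π` keeps the angles `θ - h` and `θ + h` less than a full turn apart, so that the
  -- chord is nondegenerate.
  obtain ⟨h, hh, hhη, hhπ⟩ : ∃ h > 0, h < η ∧ h < Real.pi :=
    ⟨min η Real.pi / 2, by have := Real.pi_pos; positivity,
      by have := min_le_left η Real.pi; have : 0 < min η Real.pi := by have := Real.pi_pos; positivity
         linarith,
      by have := min_le_right η Real.pi; have : 0 < min η Real.pi := by have := Real.pi_pos; positivity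
         linarith⟩
  have hpi := Real.pi_pos
  obtain ⟨hx1, hx2⟩ := hηs (y := θ - h) (by rw [Real.dist_eq, abs_lt]; constructor <;> linarith)
  obtain ⟨hy1, hy2⟩ := hηs (y := θ + h) (by rw [Real.dist_eq, abs_lt]; constructor <;> linarith)
  set x := circlePoint γ.center γ.radius (θ - h)
  set y := circlePoint γ.center γ.radius (θ + h)
  have hxγ : x ∈ γ.carrier := ⟨_, hx2, rfl⟩
  have hyγ : y ∈ γ.carrier := ⟨_, hy2, rfl⟩
  have hxy : x ≠ y := fun hxy => by
    have := eq_of_circlePoint_eq hr hxy (by rw [abs_lt]; constructor <;> linarith)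
    linarith
  refine hdent x hxγ y hyγ hxy ?_
  rw [← insert_endpoints_openSegment]
  refine insert_subset (hB.carrier_subset hγF hxγ) (insert_subset (hB.carrier_subset hγF hyγ) ?_)
  intro z hz
  refine interior_subset (hTi (hTδ ⟨(convex_ball p δ₂).segment_subset hx1 hy1
    (openSegment_subset_segment _ _ _ hz), ?_⟩))
  have := (strictConvex_closedBall ℝ γ.center γ.radius).openSegment_subset
    (mem_closedBall.2 (hsphere x hxγ).le) (mem_closedBall.2 (hsphere y hyγ).le) hxy hz
  rw [interior_closedBall _ hr.ne'] at this
  rw [mem_ofPred_eq]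
  exact sub_neg.2 (mem_ball.1 this)

theorem dist_circlePoint_circlePoint (c : Plane) (ρ ρ' θ : ℝ) :
    dist (circlePoint c ρ θ) (circlePoint c ρ' θ) = |ρ - ρ'| := by
  rw [circlePoint_eq, circlePoint_eq, dist_add_left, dist_eq_norm, ← sub_smul, norm_smul,
    norm_unit, mul_one, Real.norm_eq_abs]

/-- A point whose nearest point on an arc is an inner point of this arc lies on the corresponding
ray from the center. -/
theorem eq_circlePoint_of_nearest {x c : Plane} {r θ a b : ℝ} (hr : 0 < r) (hθ : θ ∈ Ioo a b)
    (hmin : ∀ t ∈ Ioo a b, dist x (circlePoint c r θ) ≤ dist x (circlePoint c r t)) :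
    ∃ s ≥ 0, x = circlePoint c s θ := by
  have hsq : ∀ t, dist x (circlePoint c r t) ^ 2 =
      inner ℝ (x - c) (x - c) + r ^ 2 - 2 * r * inner ℝ (x - c) (unit t) := by
    intro t
    rw [dist_eq_norm, ← real_inner_self_eq_norm_sq, circlePoint_eq]
    simp only [inner_eq, PiLp.sub_apply, PiLp.add_apply, PiLp.smul_apply, smul_eq_mul, unit_zero,
      unit_one]
    linear_combination r ^ 2 * Real.cos_sq_add_sin_sq t
  have hle : ∀ t ∈ Ioo a b, inner ℝ (x - c) (unit t) ≤ inner ℝ (x - c) (unit θ) := by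
    intro t ht
    have h1 := pow_le_pow_left₀ dist_nonneg (hmin t ht) 2
    rw [hsq, hsq] at h1
    have : 0 ≤ 2 * r * (inner ℝ (x - c) (unit θ) - inner ℝ (x - c) (unit t)) := by linarith
    linarith [nonneg_of_mul_nonneg_right this (by positivity)]
  -- Minimal distance on the circle is maximal inner product with `unit t`; the vanishing derivative
  -- says that `x - c` has no tangential component.
  have hmax : IsLocalMax (fun t => inner ℝ (x - c) (unit t)) θ := by
    filter_upwards [Ioo_mem_nhds hθ.1 hθ.2] with t ht using hle t ht
  have hder : HasDerivAt (fun t => inner ℝ (x - c) (unit t))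
      ((x - c) 0 * -Real.sin θ + (x - c) 1 * Real.cos θ) θ := by
    simp only [inner_eq, unit_zero, unit_one]
    exact ((Real.hasDerivAt_cos θ).const_mul _).add ((Real.hasDerivAt_sin θ).const_mul _)
  have hzero := hmax.hasDerivAt_eq_zero hder
  have hx : x = circlePoint c (inner ℝ (x - c) (unit θ)) θ := by
    have hcs := Real.cos_sq_add_sin_sq θ
    rw [circlePoint_eq, ← sub_eq_iff_eq_add']
    refine ext_plane ?_ ?_ <;>
      simp only [inner_eq, PiLp.smul_apply, unit_zero, unit_one, smul_eq_mul]
    · linear_combination (-(x - c) 0) * hcs - Real.sin θ * hzero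
    · linear_combination (-(x - c) 1) * hcs + Real.cos θ * hzero
  refine ⟨_, ?_, hx⟩
  -- Turning by a small `t` multiplies the inner product by `cos t < 1`, so a negative value would
  -- not be maximal.
  obtain ⟨t, ht0, htb, htπ⟩ : ∃ t > 0, θ + t < b ∧ t < Real.pi := by
    refine ⟨min (b - θ) Real.pi / 2, ?_, ?_, ?_⟩ <;>
    · have h1 := min_le_left (b - θ) Real.pi
      have h2 := min_le_right (b - θ) Real.pi
      have h3 : 0 < min (b - θ) Real.pi := lt_min (sub_pos.2 hθ.2) Real.pi_pos
      linarith
  have h1 := hle (θ + t) ⟨by linarith [hθ.1], htb⟩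
  have h2 : inner ℝ (x - c) (unit (θ + t)) = inner ℝ (x - c) (unit θ) * Real.cos t := by
    simp only [inner_eq, unit_zero, unit_one, Real.cos_add, Real.sin_add]
    linear_combination Real.sin t * hzero
  have h3 : Real.cos t < 1 := by
    rw [← Real.cos_zero]
    exact Real.cos_lt_cos_of_nonneg_of_le_pi le_rfl htπ.le ht0
  rw [h2] at h1
  nlinarith

/-- A point whose nearest point in the region is an inner point of a dent is at most as far away
as the radius of the dent. -/
theorem dist_le_radius_of_nearest {P : Set Plane} {F : Set Piece}
    (hB : BoundaryConsistsOf P F) {γ : CircularArc} (hγF : Piece.arc γ ∈ F)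
    (hdent : IsDent P γ) (hint : γ.carrier ⊆ closure (interior P)) {θ : ℝ}
    (hθ : θ ∈ Ioo γ.startAngle γ.endAngle) {x : Plane}
    (hmin : ∀ y ∈ P, dist x (circlePoint γ.center γ.radius θ) ≤ dist x y) :
    dist x (circlePoint γ.center γ.radius θ) ≤ γ.radius := by
  have hr := γ.radius_pos
  obtain ⟨s, hs, rfl⟩ := eq_circlePoint_of_nearest hr hθ fun t ht =>
    hmin _ (hB.carrier_subset hγF ⟨t, Ioo_subset_Icc_self ht, rfl⟩)
  rw [dist_circlePoint_circlePoint]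
  rcases le_or_gt s γ.radius with h | h
  · rw [abs_sub_comm, abs_of_nonneg] <;> linarith
  -- Beyond the circle, `x` would be closer to points of `P` on the same ray just outside the arc.
  obtain ⟨δ, hδ, hδP⟩ := exists_ball_inter_subset_interior hB hγF hdent hint hθ
  obtain ⟨ρ, hρ, hρδ, hρs⟩ : ∃ ρ > γ.radius, ρ < γ.radius + δ ∧ ρ < s := by
    obtain ⟨ρ, h1, h2⟩ := exists_between (lt_min (lt_add_of_pos_right γ.radius hδ) h)
    exact ⟨ρ, h1, h2.trans_le (min_le_left _ _), h2.trans_le (min_le_right _ _)⟩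
  have hρP : circlePoint γ.center ρ θ ∈ P := by
    refine interior_subset (hδP ⟨?_, ?_⟩)
    · rw [mem_ball, dist_circlePoint_circlePoint, abs_of_pos] <;> linarith
    · simpa only [mem_ofPred_eq, dist_circlePoint (hr.trans hρ).le θ] using hρ
  have := hmin _ hρP
  rw [dist_circlePoint_circlePoint, dist_circlePoint_circlePoint, abs_of_pos, abs_of_pos] at this <;>
    linarith

/-- From an interior point, a small move towards `x` stays in `P` and decreases the distance. -/
theorem mem_frontier_of_nearest {P : Set Plane} {x q : Plane} (hq : q ∈ P) (hxq : x ≠ q)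
    (hmin : ∀ y ∈ P, dist x q ≤ dist x y) : q ∈ frontier P := by
  refine ⟨subset_closure hq, fun hqi => ?_⟩
  have h1 : ∀ᶠ t in 𝓝 (0 : ℝ), AffineMap.lineMap q x t ∈ P := by
    refine (AffineMap.lineMap_continuous (R := ℝ)).continuousAt.eventually_mem ?_
    simpa using mem_interior_iff_mem_nhds.1 hqi
  obtain ⟨t, ht, ht0, ht1⟩ := ((h1.filter_mono nhdsWithin_le_nhds).and
    (Ioo_mem_nhdsGT (zero_lt_one' ℝ))).exists
  have := hmin _ ht
  rw [dist_comm x (AffineMap.lineMap q x t), dist_lineMap_right, Real.norm_eq_abs,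
    abs_of_pos (by linarith), dist_comm q x] at this
  nlinarith [dist_pos.2 hxq]

/-- A nearest point in an indented region with radius `r` at distance more than `r` lies on a
boundary segment or is an endpoint of a boundary piece. -/
theorem nearest_mem_seg_or_endpoint {P : Set Plane} {F : Set Piece} {r : ℝ} (hr : 0 < r)
    (hB : BoundaryConsistsOf P F)
    (hF : ∀ γ, Piece.arc γ ∈ F → γ.radius = r ∧ IsDent P γ ∧ γ.carrier ⊆ closure (interior P))
    {x q : Plane} (hq : q ∈ P) (hxq : r < dist x q) (hmin : ∀ y ∈ P, dist x q ≤ dist x y) :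
    (∃ s, Piece.seg s ∈ F ∧ q ∈ segment ℝ s.source s.target) ∨ ∃ p ∈ F, q ∈ p.endpoints := by
  have hfr := mem_frontier_of_nearest hq (dist_pos.1 (hr.trans hxq)) hmin
  rw [hB.frontier_eq] at hfr
  obtain ⟨p, hp, hqp⟩ := mem_iUnion₂.1 hfr
  cases p with
  | seg s => exact Or.inl ⟨s, hp, hqp⟩
  | arc γ =>
    obtain ⟨θ, hθ, rfl⟩ := hqp
    obtain ⟨hγr, hdent, hint⟩ := hF γ hp
    rcases hθ.1.eq_or_lt with h1 | h1
    · exact Or.inr ⟨_, hp, Or.inl (by rw [h1])⟩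
    rcases hθ.2.eq_or_lt with h2 | h2
    · exact Or.inr ⟨_, hp, Or.inr (by rw [h2]; rfl)⟩
    have := dist_le_radius_of_nearest hB hp hdent hint ⟨h1, h2⟩ hmin
    rw [hγr] at this hxq
    exact absurd hxq this.not_gt

/-! ### Tangent segments at endpoints of dents -/

/-- A circle through `v` does not, near `v`, enter the region between another circle through `v`
of the same radius and its tangent. -/
theorem eventually_dist_ne {v c c' : Plane} {r : ℝ} (hr : 0 < r) (hc : dist v c = r)
    (hc' : dist v c' = r) :
    ∀ᶠ f in 𝓝 v, r < dist f c → inner ℝ (v - c) (f - v) ≤ 0 → dist f c' ≠ r := by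
  set N := v - c with hN
  set M := v - c' with hM
  have hNN : inner ℝ N N = r ^ 2 := by rw [real_inner_self_eq_norm_sq, ← dist_eq_norm, hc]
  have hMM : inner ℝ M M = r ^ 2 := by rw [real_inner_self_eq_norm_sq, ← dist_eq_norm, hc']
  set α := inner ℝ M N with hα
  set β := inner ℝ M (rot N) with hβ
  have hαβ : α ^ 2 + β ^ 2 = r ^ 4 := by
    have : α ^ 2 + β ^ 2 = inner ℝ M M * inner ℝ N N := by
      simp only [hα, hβ, inner_eq, rot_zero, rot_one]; ring
    rw [this, hNN, hMM]; ring
  have hexp : ∀ f d : Plane, dist f d ^ 2 =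
      inner ℝ (f - v) (f - v) + 2 * inner ℝ (v - d) (f - v) + inner ℝ (v - d) (v - d) := by
    intro f d
    rw [dist_eq_norm, ← real_inner_self_eq_norm_sq]
    simp only [inner_eq, PiLp.sub_apply]; ring
  have hsmall : β ≠ 0 → ∀ᶠ f in 𝓝 v, r ^ 4 * inner ℝ (f - v) (f - v) <
      β ^ 2 * (r ^ 2 - inner ℝ (f - v) (f - v) / 4) := by
    intro hβ0
    refine ContinuousAt.eventually_lt (by fun_prop) (by fun_prop) ?_
    simp only [sub_self, inner_zero_left]
    rw [mul_zero, zero_div, sub_zero]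
    positivity
  have hsmall' : ∀ᶠ f in 𝓝 v, β ≠ 0 → r ^ 4 * inner ℝ (f - v) (f - v) <
      β ^ 2 * (r ^ 2 - inner ℝ (f - v) (f - v) / 4) := by
    by_cases hβ0 : β = 0
    · exact Eventually.of_forall fun f h => (h hβ0).elim
    · exact (hsmall hβ0).mono fun f h _ => h
  filter_upwards [hsmall'] with f hf h1 h2 h3
  have e1 := hexp f c
  have e2 := hexp f c'
  rw [← hN, hNN] at e1
  rw [← hM, hMM, h3] at e2
  have h1' : r ^ 2 < dist f c ^ 2 := pow_lt_pow_left₀ h1 hr.le two_ne_zero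
  -- `X / r` and `Y / r` are the tangential and normal components of `f - v`. Between circle and
  -- tangent `|Y| ≤ W / 2`, which is of second order.
  set W := inner ℝ (f - v) (f - v) with hW
  set Y := inner ℝ N (f - v) with hY
  set X := inner ℝ (rot N) (f - v) with hX
  have i1 : r ^ 2 * inner ℝ M (f - v) = α * Y + β * X := by
    rw [← hNN]
    simp only [hα, hβ, hX, hY, inner_eq, rot_zero, rot_one]; ring
  have i2 : X ^ 2 + Y ^ 2 = W * r ^ 2 := by
    rw [← hNN]
    simp only [hW, hX, hY, inner_eq, rot_zero, rot_one]; ring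
  have hWY : 0 < W + 2 * Y := by linarith
  have hWpos : 0 < W := by linarith
  have h4 : r ^ 2 * W = -2 * (α * Y + β * X) := by rw [← i1]; linear_combination r ^ 2 * (-e2)
  by_cases hβ0 : β = 0
  -- The normals are parallel: the circles are equal (`α = r ^ 2`) or touch from opposite sides (`α
  -- = -r ^ 2`).
  · rw [hβ0] at h4 hαβ
    have hα2 : (α - r ^ 2) * (α + r ^ 2) = 0 := by linear_combination hαβ
    rcases mul_eq_zero.1 hα2 with h | h
    · have : r ^ 2 * (W + 2 * Y) = 0 := by linear_combination h4 + (-2 * Y) * h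
      have : 0 < r ^ 2 * (W + 2 * Y) := by positivity
      linarith
    · have h5 : r ^ 2 * (W - 2 * Y) = 0 := by linear_combination h4 - 2 * Y * h
      have : 0 < r ^ 2 * (W - 2 * Y) := by
        have : 0 < W - 2 * Y := by linarith
        positivity
      linarith
  · have h5 := hf hβ0
    -- The circles cross at `v`. On the second one `β * X` is at most of order `W`, but `X ^ 2 = W *
    -- r ^ 2 - Y ^ 2` is itself of order `W`, which is impossible for small `W`.
    have hαle : |α| ≤ r ^ 2 := abs_le_of_sq_le_sq (by nlinarith [sq_nonneg β]) (by positivity)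
    have hYle : |Y| ≤ W / 2 := by rw [abs_le]; constructor <;> linarith
    have h6 : |β * X| ≤ r ^ 2 * W := by
      have e : β * X = -(r ^ 2 * W) / 2 - α * Y := by linarith
      have : |α * Y| ≤ r ^ 2 * (W / 2) := by
        rw [abs_mul]; gcongr
      rw [e]
      rw [abs_le] at this ⊢
      have : 0 < r ^ 2 * W := by positivity
      constructor <;> linarith
    have h7 : (β * X) ^ 2 ≤ (r ^ 2 * W) ^ 2 := by
      rw [← sq_abs (β * X)]
      gcongr
    have h8 : Y ^ 2 ≤ (W / 2) ^ 2 := by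
      rw [← sq_abs Y]
      gcongr
    have h9 : β ^ 2 * (r ^ 2 - W / 4) * W ≤ r ^ 4 * W * W := by
      have : β ^ 2 * (W * r ^ 2 - (W / 2) ^ 2) ≤ β ^ 2 * X ^ 2 := by
        gcongr; linarith
      nlinarith
    exact absurd (mul_lt_mul_of_pos_right h5 hWpos) h9.not_gt

/-- Polar coordinates on the tangent: the ray turned by `t` meets it in a right triangle with leg
`r` and hypotenuse `r / cos t`. The sign `σ` selects the direction. -/
theorem circlePoint_tangent {c : Plane} {r θ σ t : ℝ} (hσ : σ = 1 ∨ σ = -1)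
    (ht : Real.cos t ≠ 0) :
    circlePoint c (r / Real.cos t) (θ + σ * t) =
      circlePoint c r θ + (r * Real.tan t * σ) • rot (unit θ) := by
  rw [Real.tan_eq_sin_div_cos]
  refine ext_plane ?_ ?_ <;>
    simp only [circlePoint_eq, PiLp.add_apply, PiLp.smul_apply, smul_eq_mul, unit_zero, unit_one,
      rot_zero, rot_one] <;>
    rcases hσ with rfl | rfl <;>
    simp only [one_mul, neg_mul, mul_one, mul_neg, Real.cos_add, Real.sin_add, Real.cos_neg,
      Real.sin_neg] <;>
    field_simp <;> ring

/-- At an endpoint of a dent that is not on a boundary segment, a piece of the tangent ray lies in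
the region. -/
theorem exists_tangent_segment_subset {P : Set Plane} {F : Set Piece} {r : ℝ} (hr : 0 < r)
    (hB : BoundaryConsistsOf P F)
    (hF : ∀ γ, Piece.arc γ ∈ F → γ.radius = r ∧ IsDent P γ ∧ γ.carrier ⊆ closure (interior P))
    {γ : CircularArc} (hγF : Piece.arc γ ∈ F) {θ σ η : ℝ} (hσ : σ = 1 ∨ σ = -1) (hη : 0 < η)
    (hθ : ∀ t ∈ Ioo 0 η, θ + σ * t ∈ Ioo γ.startAngle γ.endAngle)
    (hvP : circlePoint γ.center γ.radius θ ∈ P)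
    (hv : ∀ s, Piece.seg s ∈ F → circlePoint γ.center γ.radius θ ∉ segment ℝ s.source s.target) :
    ∃ w ≠ circlePoint γ.center γ.radius θ, segment ℝ (circlePoint γ.center γ.radius θ) w ⊆ P := by
  obtain ⟨hγr, hdent, hint⟩ := hF γ hγF
  rw [hγr] at hvP hv ⊢
  set c := γ.center
  set v := circlePoint c r θ with hvdef
  have hvc : dist v c = r := dist_circlePoint hr.le θ
  have hvc' : v - c = r • unit θ := by rw [hvdef, circlePoint_eq, add_sub_cancel_left]
  -- The sliver between circle and tangent contains no frontier point near `v`: pieces through `v`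
  -- are arcs of radius `r`, because `v` is on no boundary segment, and the other pieces stay away
  -- from `v`.
  have hsliver : ∀ᶠ f in 𝓝 v, r < dist f c → inner ℝ (v - c) (f - v) ≤ 0 → f ∉ frontier P := by
    have : ∀ᶠ f in 𝓝 v, ∀ q ∈ F, r < dist f c → inner ℝ (v - c) (f - v) ≤ 0 → f ∉ q.carrier := by
      refine (eventually_all_finite hB.finite).2 fun q hq => ?_
      by_cases hvq : v ∈ q.carrier
      · cases q with
        | seg s => exact (hv s hq hvq).elim
        | arc γ' =>
          have hsph : ∀ x ∈ γ'.carrier, dist x γ'.center = r := by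
            rintro _ ⟨t, -, rfl⟩
            rw [← (hF γ' hq).1]
            exact dist_circlePoint γ'.radius_pos.le t
          exact (eventually_dist_ne hr hvc (hsph v hvq)).mono fun f hf h1 h2 h3 =>
            hf h1 h2 (hsph f h3)
      · filter_upwards [q.isCompact_carrier.isClosed.isOpen_compl.mem_nhds hvq] with f hf _ _
        exact hf
    filter_upwards [this] with f hf h1 h2 h3
    rw [hB.frontier_eq] at h3
    obtain ⟨q, hq, hfq⟩ := mem_iUnion₂.1 h3
    exact hf q hq h1 h2 hfq
  obtain ⟨δ, hδ, hδs⟩ := Metric.mem_nhds_iff.1 hsliver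
  -- The length of the radial segment between circle and tangent, plus the distance of its tangent
  -- end from `v`.
  have hsmall : ∀ᶠ t in 𝓝 (0 : ℝ), r / Real.cos t - r + r * |Real.tan t| < δ := by
    refine ContinuousAt.eventually_lt (g := fun _ => δ) ?_ continuousAt_const (by simpa using hδ)
    have h0 : Real.cos 0 ≠ 0 := by simp
    have := (Real.continuousAt_tan.2 h0).abs
    have h2 := Real.continuous_cos.continuousAt (x := 0)
    exact ((continuousAt_const.div h2 h0).sub continuousAt_const).add (continuousAt_const.mul this)
  obtain ⟨κ, hκ, hκs⟩ := Metric.eventually_nhds_iff.1 hsmall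
  have hpi := Real.pi_pos
  obtain ⟨t₁, ht₁, ht₁'⟩ := exists_between (show 0 < min (min κ η) (Real.pi / 2) by positivity)
  obtain ⟨⟨ht₁κ, ht₁η⟩, ht₁π⟩ : (t₁ < κ ∧ t₁ < η) ∧ t₁ < Real.pi / 2 := by
    simpa only [lt_min_iff] using ht₁'
  have hpoint : ∀ t, 0 < t → t ≤ t₁ → v + (r * Real.tan t * σ) • rot (unit θ) ∈ P := by
    intro t ht htt
    have hcos : 0 < Real.cos t := Real.cos_pos_of_mem_Ioo ⟨by linarith, by linarith⟩
    have hcos1 : Real.cos t < 1 := by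
      rw [← Real.cos_zero]
      exact Real.cos_lt_cos_of_nonneg_of_le_pi le_rfl (by linarith) ht
    have hrt : r < r / Real.cos t := by rw [lt_div_iff₀ hcos]; nlinarith
    have hθt := hθ t ⟨ht, htt.trans_lt ht₁η⟩
    have hy := circlePoint_tangent (c := c) (r := r) (θ := θ) hσ hcos.ne'
    rw [← hvdef] at hy
    rw [← hy]
    -- The radial segment from the arc (excluded) to the tangent avoids the frontier and starts in
    -- the interior of `P`, so its tangent end is in `P`.
    have hpre : IsPreconnected ((fun ρ => circlePoint c ρ (θ + σ * t)) '' Ioc r (r / Real.cos t)) :=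
      isPreconnected_Ioc.image _ (by simp only [circlePoint_eq]; fun_prop)
    have hdisj : Disjoint ((fun ρ => circlePoint c ρ (θ + σ * t)) '' Ioc r (r / Real.cos t))
        (frontier P) := by
      rw [disjoint_left]
      rintro _ ⟨ρ, ⟨hρ1, hρ2⟩, rfl⟩
      refine hδs ?_ ?_ ?_
      · have h1 : dist (circlePoint c ρ (θ + σ * t)) (circlePoint c (r / Real.cos t) (θ + σ * t)) ≤
            r / Real.cos t - r := by
          rw [dist_circlePoint_circlePoint, abs_sub_comm, abs_of_nonneg] <;> linarith
        have h2 : dist (circlePoint c (r / Real.cos t) (θ + σ * t)) v = r * |Real.tan t| := by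
          have : |σ| = 1 := by rcases hσ with rfl | rfl <;> simp
          rw [hy, dist_eq_norm, add_sub_cancel_left, norm_smul, norm_rot, norm_unit,
            Real.norm_eq_abs, abs_mul, abs_mul, this, abs_of_pos hr, mul_one, mul_one]
        have h3 := hκs (y := t) (by rw [Real.dist_eq, sub_zero, abs_of_pos ht]; linarith)
        rw [mem_ball]
        linarith [dist_triangle (circlePoint c ρ (θ + σ * t))
          (circlePoint c (r / Real.cos t) (θ + σ * t)) v]
      · rwa [dist_circlePoint (hr.trans hρ1).le]
      · have h1 : inner ℝ (v - c) (circlePoint c ρ (θ + σ * t) - v) =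
            r * (ρ * Real.cos t - r) := by
          have h2 : circlePoint c ρ (θ + σ * t) - v = ρ • unit (θ + σ * t) - r • unit θ := by
            rw [hvdef, circlePoint_eq, circlePoint_eq]; abel
          have h3 : inner ℝ (unit θ) (unit (θ + σ * t)) = Real.cos t := by
            have h4 : Real.cos (θ + σ * t - θ) = Real.cos t := by
              rw [add_sub_cancel_left]
              rcases hσ with rfl | rfl <;> simp
            rw [← h4, Real.cos_sub, inner_eq]
            simp only [unit_zero, unit_one]; ring
          rw [h2, hvc', real_inner_smul_left, inner_sub_right, real_inner_smul_right,
            real_inner_smul_right, h3, inner_unit_self]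
          ring
        rw [h1]
        have : ρ * Real.cos t ≤ r := by rwa [le_div_iff₀ hcos] at hρ2
        nlinarith
    obtain ⟨δ', hδ', hδP⟩ := exists_ball_inter_subset_interior hB hγF hdent hint hθt
    rw [hγr] at hδP
    obtain ⟨ρ, hρ1, hρ2⟩ := exists_between (lt_min hrt (lt_add_of_pos_right r hδ'))
    have hρP : circlePoint c ρ (θ + σ * t) ∈ interior P := by
      refine hδP ⟨?_, ?_⟩
      · have := hρ2.trans_le (min_le_right _ _)
        rw [mem_ball, dist_circlePoint_circlePoint, abs_of_pos] <;> linarith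
      · show r < _
        rwa [dist_circlePoint (hr.trans hρ1).le]
    refine interior_subset ((subset_interior_or_subset_compl hpre hdisj).resolve_right
      (fun h => h ⟨ρ, ⟨hρ1, (hρ2.trans_le (min_le_left _ _)).le⟩, rfl⟩
        (subset_closure (interior_subset hρP))) ⟨_, ⟨hrt, le_rfl⟩, rfl⟩)
  have htan : 0 < Real.tan t₁ := Real.tan_pos_of_pos_of_lt_pi_div_two ht₁ ht₁π
  refine ⟨v + (r * Real.tan t₁ * σ) • rot (unit θ), ?_, ?_⟩
  · have hσ0 : σ ≠ 0 := by rcases hσ with rfl | rfl <;> simp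
    have hu : rot (unit θ) ≠ 0 := by
      rw [← norm_ne_zero_iff, norm_rot, norm_unit]; exact one_ne_zero
    simp only [ne_eq, add_eq_left, smul_eq_zero, hu, or_false]
    positivity
  · rw [segment_eq_image']
    rintro _ ⟨a, ⟨ha0, ha1⟩, rfl⟩
    rcases ha0.eq_or_lt with rfl | ha0
    · simpa using hvP
    -- The point at fraction `a` of the segment belongs to the angle `arctan (a * tan t₁)`.
    · have h1 : Real.arctan (a * Real.tan t₁) ≤ t₁ := by
        rw [← Real.arctan_tan (x := t₁) (by linarith) ht₁π]
        refine Real.arctan_strictMono.monotone ?_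
        rw [Real.arctan_tan (by linarith) ht₁π]
        nlinarith
      have h2 := hpoint _ (Real.arctan_pos.2 (by positivity)) h1
      rw [Real.tan_arctan] at h2
      convert h2 using 2
      rw [add_sub_cancel_left, smul_smul]
      congr 1
      ring

/-- Every endpoint of a boundary piece is an end of a nondegenerate segment in the region. -/
theorem exists_lineSegment_of_endpoint {P : Set Plane} {F : Set Piece} {r : ℝ} (hr : 0 < r)
    (hB : BoundaryConsistsOf P F)
    (hF : ∀ γ, Piece.arc γ ∈ F → γ.radius = r ∧ IsDent P γ ∧ γ.carrier ⊆ closure (interior P))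
    {p : Piece} (hp : p ∈ F) {v : Plane} (hv : v ∈ p.endpoints) :
    ∃ s : LineSegment, v ∈ segment ℝ s.source s.target ∧ segment ℝ s.source s.target ⊆ P := by
  by_cases hseg : ∃ s, Piece.seg s ∈ F ∧ v ∈ segment ℝ s.source s.target
  · obtain ⟨s, hs, hvs⟩ := hseg
    exact ⟨s, hvs, hB.carrier_subset hs⟩
  push Not at hseg
  have hvP := hB.carrier_subset hp (p.endpoints_subset_carrier hv)
  have key : ∃ w ≠ v, segment ℝ v w ⊆ P := by
    cases p with
    | seg s => exact (hseg s hp ((Piece.seg s).endpoints_subset_carrier hv)).elim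
    | arc γ =>
      have hlt := γ.start_lt_end
      rcases hv with rfl | rfl
      · exact exists_tangent_segment_subset hr hB hF hp (σ := 1) (Or.inl rfl) (sub_pos.2 hlt)
          (fun t ht => ⟨by linarith [ht.1], by linarith [ht.2]⟩) hvP hseg
      · exact exists_tangent_segment_subset hr hB hF hp (σ := -1) (Or.inr rfl) (sub_pos.2 hlt)
          (fun t ht => ⟨by linarith [ht.2], by linarith [ht.1]⟩) hvP hseg
  obtain ⟨w, hwv, hw⟩ := key
  exact ⟨⟨v, w, hwv.symm⟩, left_mem_segment ℝ _ _, hw⟩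

/-! ### Offsets and nearest points -/

theorem mem_offset {X : Set Plane} {r : ℝ} {z : Plane} :
    z ∈ offset X r ↔ ∃ p ∈ X, dist z p ≤ r := by
  rw [offset, Set.mem_add]
  constructor
  · rintro ⟨p, hp, w, hw, rfl⟩
    exact ⟨p, hp, by simpa [dist_eq_norm] using hw⟩
  · rintro ⟨p, hp, h⟩
    exact ⟨p, hp, z - p, by simpa [dist_eq_norm] using h, by abel⟩

theorem exists_nearest_of_mem_offset {X : Set Plane} (hX : IsClosed X) {r : ℝ} {z : Plane}
    (hz : z ∈ offset X r) : ∃ q ∈ X, dist z q ≤ r ∧ ∀ y ∈ X, dist z q ≤ dist z y := by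
  obtain ⟨p, hp, hpr⟩ := mem_offset.1 hz
  obtain ⟨q, hq, hqd⟩ := hX.exists_infDist_eq_dist ⟨p, hp⟩ z
  have hmin : ∀ y ∈ X, dist z q ≤ dist z y := fun y hy => hqd ▸ infDist_le_dist_of_mem hy
  exact ⟨q, hq, (hmin p hp).trans hpr, hmin⟩

/-- A dense enough part of an indented region that contains the boundary segments and the
endpoints of the boundary arcs has the same offset. -/
theorem offset_eq_of_dense {P : Set Plane} {F : Set Piece} {r₁ r₂ : ℝ} (hr₁ : 0 < r₁)
    (hB : BoundaryConsistsOf P F)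
    (hF : ∀ γ, Piece.arc γ ∈ F → γ.radius = r₁ ∧ IsDent P γ ∧ γ.carrier ⊆ closure (interior P))
    {X : Set Plane} (hXP : X ⊆ P)
    (hseg : ∀ s, Piece.seg s ∈ F → segment ℝ s.source s.target ⊆ X)
    (hend : ∀ p ∈ F, p.endpoints ⊆ X) (hdense : ∀ q ∈ P, ∃ y ∈ X, dist q y ≤ r₂ - r₁) :
    offset P r₂ = offset X r₂ := by
  refine Subset.antisymm (fun z hz => ?_) (add_subset_add_right hXP)
  obtain ⟨q, hq, hqr, hmin⟩ := exists_nearest_of_mem_offset hB.isClosed hz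
  rw [mem_offset]
  -- Up to distance `r₁` there is room to replace `q` by a point within `r₂ - r₁`; beyond it, `q`
  -- itself is among the retained points.
  rcases le_or_gt (dist z q) r₁ with h | h
  · obtain ⟨y, hy, hqy⟩ := hdense q hq
    exact ⟨y, hy, by linarith [dist_triangle z q y]⟩
  · rcases nearest_mem_seg_or_endpoint hr₁ hB hF hq h hmin with ⟨s, hs, hqs⟩ | ⟨p, hp, hqp⟩
    · exact ⟨q, hseg s hs hqs, hqr⟩
    · exact ⟨q, hend p hp hqp, hqr⟩

/-! ### The polygonal subregion -/

/-- The open square with center `a` and side length `2 * ρ`. -/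
def openSquare (a : Plane) (ρ : ℝ) : Set Plane := {x | |x 0 - a 0| < ρ ∧ |x 1 - a 1| < ρ}

theorem isOpen_openSquare (a : Plane) (ρ : ℝ) : IsOpen (openSquare a ρ) :=
  have h (i : Fin 2) : IsOpen {x : Plane | |x i - a i| < ρ} :=
    isOpen_lt (by fun_prop) continuous_const
  (h 0).inter (h 1)

theorem ball_subset_openSquare (a : Plane) (ρ : ℝ) : ball a ρ ⊆ openSquare a ρ := by
  intro x hx
  rw [mem_ball, dist_eq_norm] at hx
  exact ⟨(PiLp.norm_apply_le (x - a) 0).trans_lt hx, (PiLp.norm_apply_le (x - a) 1).trans_lt hx⟩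

theorem closure_openSquare_subset (a : Plane) (ρ : ℝ) :
    closure (openSquare a ρ) ⊆ {x | |x 0 - a 0| ≤ ρ ∧ |x 1 - a 1| ≤ ρ} :=
  have h (i : Fin 2) : IsClosed {x : Plane | |x i - a i| ≤ ρ} :=
    isClosed_le (by fun_prop) continuous_const
  closure_minimal (fun _ hx => ⟨hx.1.le, hx.2.le⟩) ((h 0).inter (h 1))

theorem closure_openSquare_subset_ball (a : Plane) {ρ : ℝ} (hρ : 0 < ρ) :
    closure (openSquare a ρ) ⊆ ball a (2 * ρ) := by
  intro x hx
  obtain ⟨h0, h1⟩ := closure_openSquare_subset a ρ hx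
  rw [mem_ball, dist_eq_norm]
  refine lt_of_pow_lt_pow_left₀ 2 (by positivity) ?_
  rw [← real_inner_self_eq_norm_sq, inner_eq, PiLp.sub_apply, PiLp.sub_apply]
  have h0' := sq_le_sq' (abs_le.1 h0).1 (abs_le.1 h0).2
  have h1' := sq_le_sq' (abs_le.1 h1).1 (abs_le.1 h1).2
  nlinarith

/-- The line on which the coordinate `i` is equal to `d`. -/
def axisLine (i : Fin 2) (d : ℝ) : Set Plane := {x | x i = d}

theorem isLine_axisLine (i : Fin 2) (d : ℝ) : IsLine (axisLine i d) := by
  refine ⟨EuclideanSpace.single i 1, by simp, d, ?_⟩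
  ext x
  simp [axisLine, EuclideanSpace.inner_single_left, sub_eq_zero]

theorem frontier_openSquare_subset (a : Plane) (ρ : ℝ) : closure (openSquare a ρ) \ openSquare a ρ ⊆
    ⋃₀ {axisLine 0 (a 0 + ρ), axisLine 0 (a 0 - ρ), axisLine 1 (a 1 + ρ), axisLine 1 (a 1 - ρ)} := by
  rintro x ⟨hx, hx'⟩
  obtain ⟨h0, h1⟩ := closure_openSquare_subset a ρ hx
  have aux : ∀ i : Fin 2, |x i - a i| = ρ → x i = a i + ρ ∨ x i = a i - ρ := by
    intro i h
    rcases abs_eq (h ▸ abs_nonneg _) |>.1 h with h | h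
    · left; linarith
    · right; linarith
  simp only [sUnion_insert, sUnion_singleton, mem_union, axisLine, mem_ofPred_eq]
  rcases h0.lt_or_eq with h0 | h0
  · rcases h1.lt_or_eq with h1 | h1
    · exact (hx' ⟨h0, h1⟩).elim
    · have := aux 1 h1; tauto
  · have := aux 0 h0; tauto

/-- These segments are put back after the dents are cut off; through them every endpoint is retained
without becoming an isolated point. -/
theorem exists_lineSegments {P : Set Plane} {F : Set Piece} {r : ℝ} (hr : 0 < r)
    (hB : BoundaryConsistsOf P F)
    (hF : ∀ γ, Piece.arc γ ∈ F → γ.radius = r ∧ IsDent P γ ∧ γ.carrier ⊆ closure (interior P)) :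
    ∃ S : Set LineSegment, S.Finite ∧ (∀ s ∈ S, segment ℝ s.source s.target ⊆ P) ∧
      (∀ s, Piece.seg s ∈ F → s ∈ S) ∧
      ∀ p ∈ F, ∀ v ∈ p.endpoints, ∃ s ∈ S, v ∈ segment ℝ s.source s.target := by
  have hex : ∀ v : Plane, ∃ T : Set LineSegment, T.Finite ∧
      (∀ s ∈ T, segment ℝ s.source s.target ⊆ P) ∧
      ∀ p ∈ F, v ∈ p.endpoints → ∃ s ∈ T, v ∈ segment ℝ s.source s.target := by
    intro v
    by_cases h : ∃ p ∈ F, v ∈ p.endpoints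
    · obtain ⟨p, hp, hv⟩ := h
      obtain ⟨s, hvs, hsP⟩ := exists_lineSegment_of_endpoint hr hB hF hp hv
      exact ⟨{s}, finite_singleton s, by simpa using hsP, fun _ _ _ => ⟨s, rfl, hvs⟩⟩
    · exact ⟨∅, finite_empty, by simp, fun p hp hv => (h ⟨p, hp, hv⟩).elim⟩
  choose T hT hTP hTv using hex
  refine ⟨{s | Piece.seg s ∈ F} ∪ ⋃ p ∈ F, ⋃ v ∈ p.endpoints, T v, ?_, ?_, ?_, ?_⟩
  · exact (hB.finite.preimage (f := Piece.seg) fun s _ t _ h => by injection h).union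
      (hB.finite.biUnion fun p _ => p.finite_endpoints.biUnion fun v _ => hT v)
  · rintro s (hs | hs)
    · exact hB.carrier_subset (p := Piece.seg s) hs
    · simp only [mem_iUnion] at hs
      obtain ⟨p, -, v, -, hs⟩ := hs
      exact hTP v s hs
  · exact fun s hs => Or.inl hs
  · intro p hp v hv
    obtain ⟨s, hs, hvs⟩ := hTv v p hp hv
    exact ⟨s, Or.inr (mem_biUnion hp (mem_biUnion hv hs)), hvs⟩

/-- A compact set of limits of an open set `U` is uniformly close to points of `U` that have a
positive distance from it. -/
theorem exists_uniform_near {A U : Set Plane} (hA : IsCompact A) (hU : A ⊆ closure U)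
    (hAU : Disjoint U A) {ε : ℝ} (hε : 0 < ε) :
    ∃ η > 0, ∀ z ∈ A, ∃ b ∈ U, dist z b < ε ∧ ∀ a ∈ A, η < dist b a := by
  have h1 : ∀ z : Plane, ∃ b, z ∈ A → b ∈ U ∧ dist z b < ε / 2 := by
    intro z
    by_cases hz : z ∈ A
    · obtain ⟨b, hb, hzb⟩ := Metric.mem_closure_iff.1 (hU hz) (ε / 2) (half_pos hε)
      exact ⟨b, fun _ => ⟨hb, hzb⟩⟩
    · exact ⟨z, fun h => (hz h).elim⟩
  choose b hb using h1
  obtain ⟨t, htA, htfin, hcov⟩ := hA.finite_cover_balls (half_pos hε)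
  have h2 : ∀ᶠ η in 𝓝[>] (0 : ℝ), ∀ i ∈ t, ∀ a ∈ A, η < dist (b i) a := by
    refine (eventually_all_finite htfin).2 fun i hi => ?_
    have hbi : b i ∉ A := disjoint_left.1 hAU (hb i (htA hi)).1
    obtain ⟨κ, hκ, hκA⟩ := Metric.mem_nhds_iff.1 (hA.isClosed.isOpen_compl.mem_nhds hbi)
    filter_upwards [Ioo_mem_nhdsGT hκ] with η hη a ha
    by_contra! hle
    exact hκA (by rw [mem_ball, dist_comm]; exact hle.trans_lt hη.2) ha
  obtain ⟨η, hη, hη0⟩ := (h2.and self_mem_nhdsWithin).exists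
  refine ⟨η, hη0, fun z hz => ?_⟩
  obtain ⟨i, hi, hzi⟩ := mem_iUnion₂.1 (hcov hz)
  obtain ⟨hbU, hib⟩ := hb i (htA hi)
  rw [mem_ball] at hzi
  exact ⟨b i, hbU, by linarith [dist_triangle z i (b i)], hη i hi⟩

/-- An indented region has a polygonal subregion with the same offsets for large radii. -/
theorem exists_polygonal_subregion {P : Set Plane} {r₁ r₂ : ℝ} (hr₁ : 0 < r₁) (hr₂ : r₁ < r₂)
    (hP : IsIndentedRegion P r₁) :
    ∃ X : Set Plane, IsPolygonalRegion X ∧ X ⊆ P ∧ offset P r₂ = offset X r₂ := by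
  obtain ⟨F, hB, hF⟩ := hP
  obtain ⟨S, hS, hSP, hSF, hSv⟩ := exists_lineSegments hr₁ hB hF
  set A : Set Plane := ⋃ γ ∈ {γ | Piece.arc γ ∈ F}, γ.carrier with hAdef
  have hAfin : {γ | Piece.arc γ ∈ F}.Finite :=
    hB.finite.preimage (f := Piece.arc) fun s _ t _ h => by injection h
  have hA : IsCompact A := hAfin.isCompact_biUnion fun γ _ => γ.isCompact_carrier
  have hAfr : A ⊆ frontier P := iUnion₂_subset fun γ hγ =>
    hB.carrier_subset_frontier (p := Piece.arc γ) hγ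
  have hfr : frontier P ⊆ A ∪ ⋃ s ∈ S, segment ℝ s.source s.target := by
    rw [hB.frontier_eq]
    refine iUnion₂_subset fun p hp => ?_
    cases p with
    | seg s =>
      refine Subset.trans ?_ subset_union_right
      exact subset_biUnion_of_mem (u := fun s => segment ℝ s.source s.target) (hSF s hp)
    | arc γ =>
      refine Subset.trans ?_ subset_union_left
      exact subset_biUnion_of_mem (s := {γ | Piece.arc γ ∈ F}) (u := CircularArc.carrier) hp
  have hε : 0 < (r₂ - r₁) / 2 := by linarith
  obtain ⟨η, hη, hnear⟩ := exists_uniform_near hA (iUnion₂_subset fun γ hγ => (hF γ hγ).2.2)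
    (disjoint_left.2 fun x hx hxA => (hAfr hxA).2 hx) hε
  -- The closed squares stay within `2 * ρ` of `A`. The bound by `η` keeps them away from the points
  -- `b` of `hnear`; the other bound leaves half of `r₂ - r₁` for reaching `A` and half for going on
  -- to `b`.
  obtain ⟨ρ, hρ, hρη, hρε⟩ : ∃ ρ > 0, 2 * ρ ≤ η ∧ 2 * ρ ≤ (r₂ - r₁) / 2 :=
    ⟨min η ((r₂ - r₁) / 2) / 2, by positivity, by linarith [min_le_left η ((r₂ - r₁) / 2)],
      by linarith [min_le_right η ((r₂ - r₁) / 2)]⟩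
  obtain ⟨t, htA, htfin, hcov⟩ := hA.finite_cover_balls hρ
  set O : Set Plane := ⋃ a ∈ t, openSquare a ρ with hO
  have hOopen : IsOpen O := isOpen_biUnion fun a _ => isOpen_openSquare a ρ
  have hAO : A ⊆ O := hcov.trans (iUnion₂_mono fun a _ => ball_subset_openSquare a ρ)
  have hOcl : closure O = ⋃ a ∈ t, closure (openSquare a ρ) := htfin.closure_biUnion _
  have hOnear : ∀ x ∈ closure O, ∃ a ∈ A, dist x a < 2 * ρ := by
    intro x hx
    rw [hOcl] at hx
    obtain ⟨a, ha, hxa⟩ := mem_iUnion₂.1 hx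
    exact ⟨a, htA ha, closure_openSquare_subset_ball a hρ hxa⟩
  set Z : Set Plane := ⋃ s ∈ S, segment ℝ s.source s.target with hZ
  have hZcomp : IsCompact Z := hS.isCompact_biUnion fun s _ => isCompact_segment _ _
  have hZP : Z ⊆ P := iUnion₂_subset hSP
  have hsZ : ∀ s ∈ S, segment ℝ s.source s.target ⊆ Z := fun s hs =>
    subset_biUnion_of_mem (u := fun s => segment ℝ s.source s.target) hs
  set Q : Set Plane := P ∩ Oᶜ with hQ
  have hQclosed : IsClosed Q := hB.isClosed.inter hOopen.isClosed_compl
  have hQint : interior P ∩ (closure O)ᶜ ⊆ interior Q := by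
    rw [hQ, interior_inter, interior_compl]
  -- Taking the closure of the interior discards degenerate remnants of the cutting, so that the
  -- only one-dimensional parts come from `Z`.
  set X : Set Plane := closure (interior Q) ∪ Z with hXdef
  have hXclosed : IsClosed X := isClosed_closure.union hZcomp.isClosed
  have hXP : X ⊆ P := union_subset
    ((closure_minimal interior_subset hQclosed).trans inter_subset_left) hZP
  have hfrX : frontier X ⊆ Z ∪ (closure O \ O) := by
    have h1 : frontier (closure (interior Q)) ⊆ frontier Q :=
      frontier_closure_subset.trans frontier_interior_subset
    have h2 : frontier Q ⊆ Z ∪ (closure O \ O) := by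
      intro x hx
      rcases frontier_inter_subset _ _ hx with ⟨h3, h4⟩ | ⟨-, h4⟩
      · rw [hOopen.isClosed_compl.closure_eq] at h4
        exact Or.inl ((hfr h3).resolve_left fun h => h4 (hAO h))
      · rw [frontier_compl, hOopen.frontier_eq] at h4
        exact Or.inr h4
    intro x hx
    rcases frontier_union_subset _ _ hx with ⟨h3, -⟩ | ⟨-, h3⟩
    · exact h2 (h1 h3)
    · exact Or.inl (hZcomp.isClosed.frontier_subset h3)
  refine ⟨X, ?_, hXP, ?_⟩
  · let box : Plane → Set (Set Plane) := fun a =>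
      {axisLine 0 (a 0 + ρ), axisLine 0 (a 0 - ρ), axisLine 1 (a 1 + ρ), axisLine 1 (a 1 - ρ)}
    -- The empty set of centers rules out arcs; the radius `1` is arbitrary.
    have hex : ∃ F', BoundaryConsistsOf X F' ∧ ∀ p ∈ F', IsSegOrArc ∅ 1 p := by
      refine exists_boundaryConsistsOf_isSegOrArc hXclosed
        (G := LineSegment.line '' S ∪ ⋃ a ∈ t, box a) (S := S) ?_ one_pos
        ((hS.image _).union (htfin.biUnion fun a _ => toFinite (box a))) ?_ ?_ hS
        (fun s hs => Or.inl (mem_image_of_mem _ hs)) (fun s hs => (hsZ s hs).trans subset_union_right)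
        (union_subset_union_left _ (closure_mono
          (interior_maximal (subset_closure.trans subset_union_left) isOpen_interior)))
      · have hObdd : Bornology.IsBounded (closure O) := by
          rw [hOcl, Bornology.isBounded_biUnion htfin]
          exact fun a _ => isBounded_ball.subset (closure_openSquare_subset_ball a hρ)
        exact (hZcomp.isBounded.union hObdd).subset
          (hfrX.trans (union_subset_union_right _ sdiff_subset))
      · rintro k (⟨s, -, rfl⟩ | hk)
        · exact Or.inl s.isLine
        · obtain ⟨a, -, hk⟩ := mem_iUnion₂.1 hk
          rcases hk with rfl | rfl | rfl | rfl <;> exact Or.inl (isLine_axisLine _ _)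
      · refine hfrX.trans ?_
        rintro x (hx | ⟨hx, hxO⟩)
        · obtain ⟨s, hs, hxs⟩ := mem_iUnion₂.1 hx
          exact ⟨_, Or.inl (mem_image_of_mem _ hs), s.carrier_subset_line hxs⟩
        · rw [hOcl] at hx
          obtain ⟨a, ha, hxa⟩ := mem_iUnion₂.1 hx
          obtain ⟨k, hk, hxk⟩ := frontier_openSquare_subset a ρ
            ⟨hxa, fun h => hxO (mem_biUnion ha h)⟩
          exact ⟨k, Or.inr (mem_biUnion ha hk), hxk⟩
    obtain ⟨F', hF', hgood⟩ := hex
    refine ⟨F', hF', fun p hp => (hgood p hp).resolve_right ?_⟩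
    rintro ⟨γ, -, hγ, -⟩
    exact hγ
  · refine offset_eq_of_dense hr₁ hB hF hXP
      (fun s hs => (hsZ s (hSF s hs)).trans subset_union_right) ?_ ?_
    · intro p hp v hv
      obtain ⟨s, hs, hvs⟩ := hSv p hp v hv
      exact Or.inr (hsZ s hs hvs)
    · intro q hq
      by_cases hqO : q ∈ closure O
      · obtain ⟨a, ha, hqa⟩ := hOnear q hqO
        obtain ⟨b, hb, hab, hbA⟩ := hnear a ha
        refine ⟨b, Or.inl (subset_closure (hQint ⟨hb, fun hbO => ?_⟩)), ?_⟩
        · obtain ⟨a', ha', hba'⟩ := hOnear b hbO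
          linarith [hbA a' ha']
        · linarith [dist_triangle q a b]
      · refine ⟨q, ?_, by rw [dist_self]; linarith⟩
        by_cases hqi : q ∈ interior P
        · exact Or.inl (subset_closure (hQint ⟨hqi, hqO⟩))
        · exact Or.inr ((hfr ⟨subset_closure hq, hqi⟩).resolve_left
            fun h => hqO (subset_closure (hAO h)))

/-! ### The offset as a bulged region -/

/-- A point whose nearest point on a segment is an inner point lies on a parallel of it. -/
theorem inner_rot_of_nearest {s : LineSegment} {z q : Plane} {r : ℝ}
    (hq : q ∈ segment ℝ s.source s.target) (h1 : q ≠ s.source) (h2 : q ≠ s.target)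
    (hd : dist z q = r) (hmin : ∀ y ∈ segment ℝ s.source s.target, dist z q ≤ dist z y) :
    inner ℝ (rot (s.target - s.source)) z - (inner ℝ (rot (s.target - s.source)) s.source +
      ‖s.target - s.source‖ * r) = 0 ∨
    inner ℝ (rot (s.target - s.source)) z - (inner ℝ (rot (s.target - s.source)) s.source -
      ‖s.target - s.source‖ * r) = 0 := by
  rw [segment_eq_image'] at hq hmin
  set e := s.target - s.source with he
  obtain ⟨t, ht, rfl⟩ := hq
  have ht0 : t ≠ 0 := by rintro rfl; simp at h1
  have ht1 : t ≠ 1 := by rintro rfl; simp [he] at h2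
  have ht' : t ∈ Ioo 0 1 := ⟨lt_of_le_of_ne ht.1 ht0.symm, lt_of_le_of_ne ht.2 ht1⟩
  set w := z - (s.source + t • e) with hw
  have hww : inner ℝ w w = r ^ 2 := by rw [real_inner_self_eq_norm_sq, ← dist_eq_norm, hd]
  -- First-order condition for the squared distance, a quadratic polynomial with a minimum at the
  -- inner parameter `t`.
  have horth : inner ℝ e w = 0 := by
    have hsq : ∀ u, dist z (s.source + u • e) ^ 2 =
        inner ℝ w w - 2 * (u - t) * inner ℝ e w + (u - t) ^ 2 * inner ℝ e e := by
      intro u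
      rw [dist_eq_norm, ← real_inner_self_eq_norm_sq]
      simp only [hw, inner_eq, PiLp.sub_apply, PiLp.add_apply, PiLp.smul_apply, smul_eq_mul]
      ring
    have hloc : IsLocalMin (fun u => inner ℝ w w - 2 * (u - t) * inner ℝ e w +
        (u - t) ^ 2 * inner ℝ e e) t := by
      filter_upwards [Ioo_mem_nhds ht'.1 ht'.2] with u hu
      rw [← hsq, ← hsq]
      exact pow_le_pow_left₀ dist_nonneg (hmin _ ⟨u, Ioo_subset_Icc_self hu, rfl⟩) 2
    have hder : HasDerivAt (fun u => inner ℝ w w - 2 * (u - t) * inner ℝ e w +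
        (u - t) ^ 2 * inner ℝ e e) (-2 * inner ℝ e w) t := by
      have h3 : HasDerivAt (fun u : ℝ => u - t) 1 t := (hasDerivAt_id t).sub_const t
      have h4 := (((h3.const_mul 2).mul_const (inner ℝ e w)).const_sub (inner ℝ w w)).add
        ((h3.pow 2).mul_const (inner ℝ e e))
      exact h4.congr_deriv (by simp)
    linarith [hloc.hasDerivAt_eq_zero hder]
  have hrot : inner ℝ (rot e) w = inner ℝ (rot e) z - inner ℝ (rot e) s.source := by
    rw [hw, inner_sub_right, inner_add_right, inner_smul_right, inner_rot_self]
    ring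
  have hnorm : inner ℝ (rot e) w ^ 2 = (‖e‖ * r) ^ 2 := by
    have : inner ℝ (rot e) w ^ 2 = inner ℝ e e * inner ℝ w w - inner ℝ e w ^ 2 := by
      simp only [inner_eq, rot_zero, rot_one]; ring
    rw [this, horth, hww, real_inner_self_eq_norm_sq]
    ring
  rw [hrot] at hnorm
  rcases sq_eq_sq_iff_eq_or_eq_neg.1 hnorm with h | h
  · left; linarith
  · right; linarith

/-- Offsets of an indented region for large radii are bulged regions. -/
theorem isBulgedRegion_offset {P : Set Plane} {r₁ r₂ : ℝ} (hr₁ : 0 < r₁) (hr₂ : r₁ < r₂)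
    (hP : IsIndentedRegion P r₁) : IsBulgedRegion (offset P r₂) r₂ := by
  obtain ⟨F, hB, hF⟩ := hP
  have hr₂0 := hr₁.trans hr₂
  set Y := offset P r₂ with hY
  have hYclosed : IsClosed Y := hB.isClosed.add_right_of_isCompact (isCompact_closedBall _ _)
  have hball : ∀ p ∈ P, closedBall p r₂ ⊆ Y := fun p hp z hz => mem_offset.2 ⟨p, hp, hz⟩
  -- `Y` is a union of closed disks of positive radius.
  have hYint : Y ⊆ closure (interior Y) := by
    intro z hz
    obtain ⟨p, hp, hzp⟩ := mem_offset.1 hz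
    have : ball p r₂ ⊆ interior Y :=
      interior_maximal (ball_subset_closedBall.trans (hball p hp)) isOpen_ball
    refine closure_mono this ?_
    rwa [closure_ball _ hr₂0.ne']
  have hnearest : ∀ z ∈ frontier Y, ∃ q ∈ P, dist z q = r₂ ∧ ∀ y ∈ P, dist z q ≤ dist z y := by
    intro z hz
    obtain ⟨q, hq, hqr, hmin⟩ := exists_nearest_of_mem_offset hB.isClosed
      (hYclosed.frontier_subset hz)
    refine ⟨q, hq, le_antisymm hqr (not_lt.1 fun h => hz.2 ?_), hmin⟩
    exact interior_maximal (ball_subset_closedBall.trans (hball q hq)) isOpen_ball h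
  set C : Set Plane := ⋃ p ∈ F, p.endpoints with hC
  have hCP : C ⊆ P := iUnion₂_subset fun p hp =>
    p.endpoints_subset_carrier.trans (hB.carrier_subset hp)
  let parallels : LineSegment → Set (Set Plane) := fun s =>
    {{x | inner ℝ (rot (s.target - s.source)) x - (inner ℝ (rot (s.target - s.source)) s.source +
        ‖s.target - s.source‖ * r₂) = 0},
      {x | inner ℝ (rot (s.target - s.source)) x - (inner ℝ (rot (s.target - s.source)) s.source -
        ‖s.target - s.source‖ * r₂) = 0}}
  have hex : ∃ F', BoundaryConsistsOf Y F' ∧ ∀ p ∈ F', IsSegOrArc C r₂ p := by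
    refine exists_boundaryConsistsOf_isSegOrArc hYclosed (C := C) (r := r₂)
      (G := (⋃ s ∈ {s | Piece.seg s ∈ F}, parallels s) ∪ (fun c => sphere c r₂) '' C) (S := ∅)
      ?_ hr₂0 ?_ ?_ ?_ finite_empty (by simp) (by simp) (hYint.trans subset_union_left)
    -- `P` may be unbounded, but the nearest points lie on its compact frontier.
    · obtain ⟨M, hM⟩ := hB.isCompact_frontier.isBounded.subset_closedBall 0
      refine (isBounded_closedBall (x := 0) (r := r₂ + M)).subset fun z hz => ?_
      obtain ⟨q, hq, hqr, hmin⟩ := hnearest z hz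
      have h1 := hM (mem_frontier_of_nearest hq (dist_pos.1 (hqr ▸ hr₂0)) hmin)
      rw [mem_closedBall] at h1 ⊢
      linarith [dist_triangle z q 0]
    · refine Set.Finite.union ?_ ((hB.finite.biUnion fun p _ => p.finite_endpoints).image _)
      exact (hB.finite.preimage (f := Piece.seg) fun s _ t _ h => by injection h).biUnion
        fun s _ => toFinite (parallels s)
    · rintro k (hk | ⟨c, hc, rfl⟩)
      · obtain ⟨s, -, hk⟩ := mem_iUnion₂.1 hk
        have hne := rot_ne_zero (sub_ne_zero.2 s.source_ne_target.symm)
        rcases hk with rfl | rfl <;> exact Or.inl ⟨_, hne, _, rfl⟩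
      · exact Or.inr ⟨c, hc, rfl⟩
    · intro z hz
      obtain ⟨q, hq, hqr, hmin⟩ := hnearest z hz
      have hvertex : ∀ p ∈ F, q ∈ p.endpoints → z ∈ ⋃₀ ((⋃ s ∈ {s | Piece.seg s ∈ F}, parallels s) ∪
          (fun c => sphere c r₂) '' C) := fun p hp hqp =>
        ⟨sphere q r₂, Or.inr (mem_image_of_mem _ (mem_biUnion hp hqp)), hqr⟩
      rcases nearest_mem_seg_or_endpoint hr₁ hB hF hq (hqr ▸ hr₂) hmin with
        ⟨s, hs, hqs⟩ | ⟨p, hp, hqp⟩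
      · by_cases h1 : q = s.source
        · exact hvertex _ hs (Or.inl h1)
        by_cases h2 : q = s.target
        · exact hvertex _ hs (Or.inr h2)
        rcases inner_rot_of_nearest hqs h1 h2 hqr
          (fun y hy => hmin y (hB.carrier_subset hs hy)) with h | h
        · exact ⟨_, Or.inl (mem_biUnion (show s ∈ {s | Piece.seg s ∈ F} from hs) (Or.inl rfl)), h⟩
        · exact ⟨_, Or.inl (mem_biUnion (show s ∈ {s | Piece.seg s ∈ F} from hs) (Or.inr rfl)), h⟩
      · exact hvertex p hp hqp
  obtain ⟨F', hF', hgood⟩ := hex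
  refine ⟨F', hF', fun γ hγ => ?_⟩
  have hsub := hF'.carrier_subset hγ
  obtain ⟨s, hs⟩ | ⟨γ', hγ', hcC, hrad⟩ := hgood _ hγ
  · cases hs
  obtain rfl : γ = γ' := by injection hγ'
  refine ⟨hrad, fun hdent => ?_, hsub.trans hYint⟩
  have hlt := γ.start_lt_end
  have hle := γ.end_le
  have hmem : ∀ x ∈ γ.carrier, x ∈ closedBall γ.center r₂ := by
    rintro _ ⟨t, -, rfl⟩
    rw [← hrad]
    exact (dist_circlePoint γ.radius_pos.le t).le
  have hx : circlePoint γ.center γ.radius γ.startAngle ∈ γ.carrier :=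
    mem_image_of_mem _ ⟨le_rfl, hlt.le⟩
  -- The midpoint replaces the second end of the arc, since the two ends of a full circle coincide.
  have hy : circlePoint γ.center γ.radius ((γ.startAngle + γ.endAngle) / 2) ∈ γ.carrier :=
    mem_image_of_mem _ ⟨by linarith, by linarith⟩
  -- The center is an endpoint of a piece of the boundary of `P`, so the disk spanned by the circle,
  -- and with it the chord, lies in `Y`.
  refine hdent _ hx _ hy (fun h => ?_) (((convex_closedBall γ.center r₂).segment_subset
    (hmem _ hx) (hmem _ hy)).trans (hball _ (hCP hcC)))
  have := eq_of_circlePoint_eq γ.radius_pos h (by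
    rw [abs_lt]; constructor <;> linarith [Real.pi_pos])
  linarith

end OffsetRegion

theorem mainTheorem1 (P : Set OffsetRegion.Plane) (r₁ r₂ : ℝ) (hr₁ : 0 < r₁)
    (hr₂ : r₁ < r₂) (hP : OffsetRegion.IsIndentedRegion P r₁) :
    (∃ PL : Set OffsetRegion.Plane, OffsetRegion.IsPolygonalRegion PL ∧ PL ⊆ P ∧
      OffsetRegion.offset P r₂ = OffsetRegion.offset PL r₂) ∧
    OffsetRegion.IsBulgedRegion (OffsetRegion.offset P r₂) r₂ :=
  ⟨OffsetRegion.exists_polygonal_subregion hr₁ hr₂ hP,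
    OffsetRegion.isBulgedRegion_offset hr₁ hr₂ hP⟩
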